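/- **Setting.** For a nonzero real matrix $M$ let $\mathrm{st}(M)=\|M\|_F^2/\|M\|_{\mathrm{op}}^2$ be its stable rank ($\mathrm{st}(0):=0$), where $\|\cdot\|_{\mathrm{op}}$ is the largest singular value. For $X=[x_1,\dots,x_n]\in\mathbf R^{d\times n}$ let $\mathrm{RMSNorm}(X)$ be the matrix with columns $\sqrt d\,x_t/\|x_t\|_2$. Let $L,n_{\mathrm{head}},d,k,n\ge 1$ with $d=n_{\mathrm{head}}\,d_{\mathrm{head}}$. *Embedding.* Let $(i_1,\dots,i_n)\in\{1,\dots,V\}^n$ be a fixed token sequence, $p_{\max}=\max_j \frac1n|\{t:i_t=j\}|$, let $E\in\mathbf R^{d\times V}$ have i.i.d. $\mathcal N(0,1)$ entries with columns $e_j$, and let $X^{(0)}=[e_{i_1},\dots,e_{i_n}]$. *Activation.* Let $\sigma:\mathbf R\to\mathbf R$ be $1$-Lipschitz with $\sigma(0)=0$, applied entrywise, and let $\mathrm{st}_\sigma\in\mathbf R$, $p_\sigma>0$ and numbers $P(\sigma,d,k,n)$ be such that for all dimensions $d,k,n\ge1$, every $X\in\mathbf R^{d\times n}$ with equal column norms,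 and $W\in\mathbf R^{k\times d}$ with i.i.d. $\mathcal N(0,1/d)$ entries, with probability at least $P(\sigma,d,k,n)$ both $\mathrm{st}(\sigma(WX))\le \mathrm{st}_\sigma$ and $\|\sigma(WX)\|_F^2\ge \frac{k p_\sigma}{d}\|X\|_F^2$ hold. *Network.* For $\ell=0,\dots,L-1$ set $$A^{\mathrm{rms},(\ell)}=\mathrm{RMSNorm}(X^{(\ell)}),\qquad X^{\mathrm{att},(\ell)}=X^{(\ell)}+W_O^{(\ell)}\,\mathrm{Concat}_{h\le n_{\mathrm{head}}}\bigl(W_V^{(h,\ell)}A^{\mathrm{rms},(\ell)}P^{(h,\ell)}\bigr),$$ $$A^{\mathrm{rms},(\ell)}_{\mathrm{mlp}}=\mathrm{RMSNorm}(X^{\mathrm{att},(\ell)}),\qquad B^{(\ell)}=\sigma\bigl(W_1^{(\ell)}A^{\mathrm{rms},(\ell)}_{\mathrm{mlp}}\bigr),\qquad X^{(\ell+1)}=X^{\mathrm{att},(\ell)}+W_2^{(\ell)}B^{(\ell)},$$ and $A^{\mathrm{rms}}_{\mathrm{final}}=\mathrm{RMSNorm}(X^{(L)})$, where $\mathrm{Concat}$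 stacks the $n_{\mathrm{head}}$ blocks vertically. The matrices $W_O^{(\ell)}\in\mathbf R^{d\times d}$, $W_V^{(h,\ell)}\in\mathbf R^{d_{\mathrm{head}}\times d}$, $W_1^{(\ell)}\in\mathbf R^{k\times d}$ have i.i.d. $\mathcal N(0,1/d)$ entries and $W_2^{(\ell)}\in\mathbf R^{d\times k}$ has i.i.d. $\mathcal N(0,1/k)$ entries; the weight matrices of one layer are mutually independent. The $P^{(h,\ell)}\in\mathbf R^{n\times n}$ are arbitrary random matrices whose columns are probability vectors, and for every $\ell$ the weights of layer $\ell$ are independent of the collection formed by $E$, all weights of the layers before $\ell$, and all mixing matrices $P^{(h,\ell')}$ with $\ell'\le\ell$. (So all weights are mutually independent of each other and of $E$, and $P^{(h,\ell)}$ may depend on the input $X^{(\ell)}$ of its layer and on external randomness.) **Theorem.** There are universal numerical constants $c,C>0$ such that in every such setting with $$d\ge C L^2\log(nL),\qquad k\ge C L^2\log(nL),$$ with probability at least $$1- C L e^{-c d/L^2}- C L e^{-c k/L^2}- L\bigl(1-P(\sigma,d,k,n)\bigr)$$ all of the following hold: 1. $\mathrm{st}(B^{(\ell)})\le \mathrm{st}_\sigma$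 for every $\ell=0,\dots,L-1$; 2. $\mathrm{st}(X^{(0)})\le \dfrac{1.01}{p_{\max}}$, $\ \mathrm{st}(A^{\mathrm{rms},(0)})\le \dfrac{1.03}{p_{\max}}$, $\ \mathrm{st}(A^{\mathrm{rms},(0)}_{\mathrm{mlp}})\le \dfrac{6.03}{p_{\max}}$; 3. for every $\ell=1,\dots,L-1$, $$\mathrm{st}(A^{\mathrm{rms},(\ell)})\le 2.1\,\mathrm{st}_\sigma(1+\ell)+4.3\,\frac{\mathrm{st}_\sigma}{p_\sigma}\,\ell(\ell+1),\qquad \mathrm{st}(A^{\mathrm{rms},(\ell)}_{\mathrm{mlp}})\le 6.4\,\mathrm{st}_\sigma(1+\ell)+13\,\frac{\mathrm{st}_\sigma}{p_\sigma}\,\ell(\ell+1),$$ and $\ \mathrm{st}(A^{\mathrm{rms}}_{\mathrm{final}})\le 2.1\,\mathrm{st}_\sigma(1+L)+4.3\,\dfrac{\mathrm{st}_\sigma}{p_\sigma}\,L(L+1)$. -/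

import Mathlib

open MeasureTheory ProbabilityTheory
open scoped NNReal

namespace MSITransformer

noncomputable section

/-! ### Matrix quantities -/

/-- Squared Frobenius norm. -/
def frobSq {a b : ℕ} (M : Matrix (Fin a) (Fin b) ℝ) : ℝ := ∑ i, ∑ j, M i j ^ 2

open scoped Matrix.Norms.L2Operator in
/-- Operator norm between Euclidean spaces (largest singular value). -/
def opNorm {a b : ℕ} (M : Matrix (Fin a) (Fin b) ℝ) : ℝ := ‖M‖

/-- Stable rank `‖M‖_F² / ‖M‖_op²` (with value `0` at the zero matrix). -/
def stableRank {a b : ℕ} (M : Matrix (Fin a) (Fin b) ℝ) : ℝ := frobSq M / opNorm M ^ 2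

/-- Euclidean norm of the `t`-th column. -/
def colNorm {a b : ℕ} (M : Matrix (Fin a) (Fin b) ℝ) (t : Fin b) : ℝ := √(∑ i, M i t ^ 2)

/-- Parameter-free RMS normalization: the `t`-th column becomes `√d · x_t / ‖x_t‖₂`. -/
def rmsNorm {d n : ℕ} (X : Matrix (Fin d) (Fin n) ℝ) : Matrix (Fin d) (Fin n) ℝ :=
  Matrix.of fun i t => √(d : ℝ) * (X i t / colNorm X t)

/-- Every column is a probability vector. -/
def ColumnStochastic {n : ℕ} (P : Matrix (Fin n) (Fin n) ℝ) : Prop :=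
  (∀ i t, 0 ≤ P i t) ∧ ∀ t, ∑ i, P i t = 1

/-- Matrices carry the entrywise (product) σ-algebra. -/
instance matrixMeasurableSpace {m n : Type*} : MeasurableSpace (Matrix m n ℝ) :=
  (MeasurableSpace.pi : MeasurableSpace (m → n → ℝ))

/-- Law of an `a × b` random matrix with i.i.d. entries `N(0, v)`. -/
def gaussianMatrix (a b : ℕ) (v : ℝ≥0) : Measure (Matrix (Fin a) (Fin b) ℝ) :=
  Measure.pi fun _ : Fin a => Measure.pi fun _ : Fin b => gaussianReal 0 v

/-! ### Activation function -/

/-- The mean-spike assumption on the activation `σ`, with stable-rank level `stσ`, Frobenius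
level `pσ` and success probability `Psucc d k n`: for every `X ∈ ℝ^{d × n}` whose columns have
equal norms and a Gaussian `W ∈ ℝ^{k × d}` with i.i.d. `N(0, 1/d)` entries, both bounds hold with
probability at least `Psucc d k n`. -/
structure MeanSpike (σ : ℝ → ℝ) (stσ pσ : ℝ) (Psucc : ℕ → ℕ → ℕ → ℝ) : Prop where
  lipschitz : LipschitzWith 1 σ
  map_zero : σ 0 = 0
  bound : ∀ d k n : ℕ, 1 ≤ d → 1 ≤ k → 1 ≤ n → ∀ X : Matrix (Fin d) (Fin n) ℝ,
    (∀ s t, colNorm X s = colNorm X t) →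
    Psucc d k n ≤ (gaussianMatrix k d (d : ℝ≥0)⁻¹).real
      {W | stableRank ((W * X).map σ) ≤ stσ ∧
        (k : ℝ) * pσ / d * frobSq X ≤ frobSq ((W * X).map σ)}

/-! ### Token embedding -/

/-- Empirical frequency of token `j`. -/
def tokenFreq {n V : ℕ} (tok : Fin n → Fin V) (j : Fin V) : ℝ :=
  ((Finset.univ.filter fun t => tok t = j).card : ℝ) / n

/-- Empirical frequency of the most common token. -/
def pMax {n V : ℕ} (tok : Fin n → Fin V) : ℝ := ⨆ j, tokenFreq tok j

/-- Embedded sequence: the `t`-th column is the embedding of the `t`-th token. -/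
def embed {d n V : ℕ} (tok : Fin n → Fin V) (E : Matrix (Fin d) (Fin V) ℝ) :
    Matrix (Fin d) (Fin n) ℝ :=
  E.submatrix id tok

/-! ### The transformer -/

/-- The matrices of one layer: mixing matrices `P`, value/output projections and MLP weights. -/
structure Layer (d nHead dHead k n : ℕ) where
  P : Fin nHead → Matrix (Fin n) (Fin n) ℝ
  WV : Fin nHead → Matrix (Fin dHead) (Fin d) ℝ
  WO : Matrix (Fin d) (Fin d) ℝ
  W1 : Matrix (Fin k) (Fin d) ℝ
  W2 : Matrix (Fin d) (Fin k) ℝ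

/-- Space of the Gaussian weights `(WV, WO, W1, W2)` of one layer. -/
abbrev WeightSpace (d nHead dHead k : ℕ) : Type :=
  (Fin nHead → Matrix (Fin dHead) (Fin d) ℝ) × Matrix (Fin d) (Fin d) ℝ ×
    Matrix (Fin k) (Fin d) ℝ × Matrix (Fin d) (Fin k) ℝ

/-- All weight matrices independent, entries i.i.d. centered Gaussian with variance
`1 / (input dimension)`. -/
def weightLaw (d nHead dHead k : ℕ) : Measure (WeightSpace d nHead dHead k) :=
  (Measure.pi fun _ : Fin nHead => gaussianMatrix dHead d (d : ℝ≥0)⁻¹).prod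
    ((gaussianMatrix d d (d : ℝ≥0)⁻¹).prod
      ((gaussianMatrix k d (d : ℝ≥0)⁻¹).prod (gaussianMatrix d k (k : ℝ≥0)⁻¹)))

/-- Stack the head outputs, head `0` on top. -/
def concatHeads {d nHead dHead n : ℕ} (hd : d = nHead * dHead)
    (H : Fin nHead → Matrix (Fin dHead) (Fin n) ℝ) : Matrix (Fin d) (Fin n) ℝ :=
  Matrix.of fun i t =>
    H (finProdFinEquiv.symm (Fin.cast hd i)).1 (finProdFinEquiv.symm (Fin.cast hd i)).2 t

namespace Layer

variable {d nHead dHead k n : ℕ}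

/-- The Gaussian weights of the layer. -/
def weights (θ : Layer d nHead dHead k n) : WeightSpace d nHead dHead k :=
  (θ.WV, θ.WO, θ.W1, θ.W2)

/-- Output `X + W_O · Concat_h (W_V^h · RMSNorm(X) · P^h)` of the attention sublayer. -/
def att (θ : Layer d nHead dHead k n) (hd : d = nHead * dHead) (X : Matrix (Fin d) (Fin n) ℝ) :
    Matrix (Fin d) (Fin n) ℝ :=
  X + θ.WO * concatHeads hd fun h => θ.WV h * (rmsNorm X * θ.P h)

/-- MLP post-activations `σ(W₁ · RMSNorm(X^att))`. -/
def postAct (θ : Layer d nHead dHead k n) (hd : d = nHead * dHead) (σ : ℝ → ℝ)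
    (X : Matrix (Fin d) (Fin n) ℝ) : Matrix (Fin k) (Fin n) ℝ :=
  (θ.W1 * rmsNorm (θ.att hd X)).map σ

/-- Output `X^att + W₂ · B` of the layer. -/
def out (θ : Layer d nHead dHead k n) (hd : d = nHead * dHead) (σ : ℝ → ℝ)
    (X : Matrix (Fin d) (Fin n) ℝ) : Matrix (Fin d) (Fin n) ℝ :=
  θ.att hd X + θ.W2 * θ.postAct hd σ X

end Layer

section Forward

variable {L d nHead dHead k n : ℕ} (hd : d = nHead * dHead) (σ : ℝ → ℝ)
  (θ : Fin L → Layer d nHead dHead k n) (X₀ : Matrix (Fin d) (Fin n) ℝ)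

/-- Residual stream `X^(ℓ)`, `ℓ = 0, …, L`. -/
def hidden (ℓ : Fin (L + 1)) : Matrix (Fin d) (Fin n) ℝ :=
  Fin.induction (motive := fun _ => Matrix (Fin d) (Fin n) ℝ) X₀
    (fun j X => (θ j).out hd σ X) ℓ

/-- `A^{rms,(ℓ)} = RMSNorm(X^(ℓ))`. -/
def Arms (ℓ : Fin L) : Matrix (Fin d) (Fin n) ℝ := rmsNorm (hidden hd σ θ X₀ ℓ.castSucc)

/-- `A^{rms,(ℓ)}_{mlp} = RMSNorm(X^{att,(ℓ)})`. -/
def Amlp (ℓ : Fin L) : Matrix (Fin d) (Fin n) ℝ :=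
  rmsNorm ((θ ℓ).att hd (hidden hd σ θ X₀ ℓ.castSucc))

/-- `B^(ℓ) = σ(W₁^(ℓ) A^{rms,(ℓ)}_{mlp})`. -/
def B (ℓ : Fin L) : Matrix (Fin k) (Fin n) ℝ :=
  (θ ℓ).postAct hd σ (hidden hd σ θ X₀ ℓ.castSucc)

/-- `A^{rms}_{final} = RMSNorm(X^(L))`. -/
def Afinal : Matrix (Fin d) (Fin n) ℝ := rmsNorm (hidden hd σ θ X₀ (Fin.last L))

end Forward

/-- Gaussian initialization of an `L`-layer transformer on a probability space. The embedding has
i.i.d. standard Gaussian entries; the weights of each layer are independent Gaussian matrices; the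
mixing matrices are random column-stochastic matrices; and the weights of layer `ℓ` are
independent of everything that precedes them, that is, of the embedding, the weights of the earlier
layers and the mixing matrices up to and including layer `ℓ`. In particular all weights are
mutually independent, and the mixing matrices of layer `ℓ` may depend on the input of that layer
and on further external randomness. -/
structure GaussianInit {L d nHead dHead k n V : ℕ} {Ω : Type*} [MeasurableSpace Ω] (μ : Measure Ω)
    (E : Ω → Matrix (Fin d) (Fin V) ℝ) (θ : Fin L → Ω → Layer d nHead dHead k n) : Prop where
  law_embedding : HasLaw E (gaussianMatrix d V 1) μ
  law_weights : ∀ ℓ, HasLaw (fun ω => (θ ℓ ω).weights) (weightLaw d nHead dHead k) μ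
  measurable_P : ∀ ℓ h, Measurable fun ω => (θ ℓ ω).P h
  stochastic_P : ∀ ℓ h ω, ColumnStochastic ((θ ℓ ω).P h)
  indep : ∀ ℓ, IndepFun
    (fun ω => (E ω, (fun j : {j : Fin L // j < ℓ} => (θ j ω).weights),
      fun j : {j : Fin L // j ≤ ℓ} => (θ j ω).P))
    (fun ω => (θ ℓ ω).weights) μ

end

end MSITransformer

/-!
Given the past, each sublayer adds to the residual stream `Y` a term `G * Z` with `G` Gaussian and
independent of `Y` and `Z`. For a fixed vector `x`, the norms of `Y x` and `G Z x` therefore combine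
almost as in Pythagoras' theorem. Two consequences drive the proof.

* No update destroys a direction of large norm that was present before: testing on a maximizer for
  `Y` or for `Z`, the operator norm of `Y + G * Z` is almost at least that of either summand. After
  the first layer the mean spike of the MLP activations thus keeps `‖X^(ℓ)‖_op²` above
  `0.99 · n d pσ / stσ`; in the first layer the `n · pMax` copies of the most frequent token give
  `‖X^(0)‖_op²` at least about `n d · pMax`.
* The columns of the residual stream grow slowly: their squared norms stay below a multiple of
  `(ℓ + 1)² d`.

RMS normalization makes the squared Frobenius norm equal to `n d` and divides the operator norm by
at most the largest column norm over `√d`, so the stable rank is at most quadratic in `ℓ`. The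
exceptional events have conditional probability exponentially small in `d` or `k`, and the factor
`n` from the union bound over the columns is absorbed by the logarithmic lower bounds on `d`
and `k`.
-/

namespace MSITransformer

noncomputable section

/-! ### Union bounds and Gaussian concentration -/

section UnionBound

variable {α : Type*} [MeasurableSpace α] {μ : Measure α}

lemma measureReal_not_and_le {p q : α → Prop} {ε₁ ε₂ : ℝ} (hp : μ.real {x | ¬ p x} ≤ ε₁)
    (hq : μ.real {x | ¬ q x} ≤ ε₂) : μ.real {x | ¬ (p x ∧ q x)} ≤ ε₁ + ε₂ := by
  simp only [not_and_or]
  exact (measureReal_union_le _ _).trans (add_le_add hp hq)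

lemma measureReal_not_forall_le {ι : Type*} [Fintype ι] {p : ι → α → Prop} {ε : ℝ}
    (h : ∀ i, μ.real {x | ¬ p i x} ≤ ε) : μ.real {x | ¬ ∀ i, p i x} ≤ Fintype.card ι * ε := by
  simp only [not_forall, Set.ofPred_exists]
  calc μ.real (⋃ i, {x | ¬ p i x}) ≤ ∑ i, μ.real {x | ¬ p i x} := measureReal_iUnion_fintype_le _
    _ ≤ ∑ _ : ι, ε := Finset.sum_le_sum fun i _ => h i
    _ = Fintype.card ι * ε := by rw [Finset.sum_const, Finset.card_univ, nsmul_eq_mul]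

end UnionBound

lemma exp_mul_sq_mul_gaussianPDFReal {v : ℝ≥0} (hv : v ≠ 0) (t x : ℝ) :
    gaussianPDFReal 0 v x * Real.exp (t * x ^ 2)
      = (√(2 * Real.pi * v))⁻¹ * Real.exp (-((1 - 2 * t * v) / (2 * v)) * x ^ 2) := by
  have hv' : (v : ℝ) ≠ 0 := by exact_mod_cast hv
  rw [gaussianPDFReal, mul_assoc, ← Real.exp_add]
  congr 2
  field_simp
  ring

lemma integrable_exp_mul_sq_gaussianReal {v : ℝ≥0} {t : ℝ} (h : 2 * t * v < 1) :
    Integrable (fun x => Real.exp (t * x ^ 2)) (gaussianReal 0 v) := by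
  rcases eq_or_ne v 0 with rfl | hv
  · rw [gaussianReal_zero_var]
    exact integrable_dirac (by simp)
  have : 0 < (v : ℝ) := by positivity
  rw [gaussianReal_of_var_ne_zero _ hv, integrable_withDensity_iff_integrable_smul₀'
    (measurable_gaussianPDF _ _).aemeasurable (ae_of_all _ fun _ => gaussianPDF_lt_top)]
  simp only [toReal_gaussianPDF, smul_eq_mul, exp_mul_sq_mul_gaussianPDFReal hv]
  exact (integrable_exp_neg_mul_sq (div_pos (by linarith) (by positivity))).const_mul _

lemma mgf_sq_gaussianReal {v : ℝ≥0} {t : ℝ} (h : 2 * t * v < 1) :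
    mgf (fun x => x ^ 2) (gaussianReal 0 v) t = (√(1 - 2 * t * v))⁻¹ := by
  rcases eq_or_ne v 0 with rfl | hv
  · simp [mgf, gaussianReal_zero_var]
  have : 0 < (v : ℝ) := by positivity
  have : 1 - 2 * t * v ≠ 0 := by linarith
  simp only [mgf, integral_gaussianReal_eq_integral_smul hv, smul_eq_mul,
    exp_mul_sq_mul_gaussianPDFReal hv, integral_const_mul, integral_gaussian]
  rw [← Real.sqrt_inv, ← Real.sqrt_inv, ← Real.sqrt_mul (by positivity)]
  congr 1
  field_simp

lemma inv_sqrt_one_sub_two_mul_le_exp {u : ℝ} (hu : u ≤ 1 / 4) :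
    (√(1 - 2 * u))⁻¹ ≤ Real.exp (u + 4 * u ^ 2) := by
  rw [← Real.sqrt_inv]
  refine Real.sqrt_le_iff.mpr ⟨by positivity, ?_⟩
  rw [← Real.exp_nat_mul, inv_le_iff_one_le_mul₀ (by linarith)]
  have hexp := Real.add_one_le_exp (↑(2 : ℕ) * (u + 4 * u ^ 2))
  calc (1 : ℝ) ≤ (2 * u + 8 * u ^ 2 + 1) * (1 - 2 * u) := by
        nlinarith [mul_nonneg (sq_nonneg u) (sub_nonneg.mpr hu)]
    _ ≤ _ := by
        gcongr
        · linarith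
        · push_cast at hexp ⊢
          linarith

section GaussianSums

variable {ι Ω : Type*} [Fintype ι] [MeasurableSpace Ω] {μ : Measure Ω} {X : ι → Ω → ℝ} {s : ι → ℝ≥0}

lemma hasLaw_sum_mul_gaussianReal (hindep : iIndepFun X μ)
    (hlaw : ∀ i, HasLaw (X i) (gaussianReal 0 (s i)) μ) (y : ι → ℝ) :
    HasLaw (fun ω => ∑ i, X i ω * y i) (gaussianReal 0 (∑ i, s i * ‖y i‖₊ ^ 2)) μ where
  aemeasurable := Finset.aemeasurable_fun_sum _ fun i _ => (hlaw i).aemeasurable.mul_const _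
  map_eq := by
    have := hindep.isProbabilityMeasure
    have hlaw_mul := fun i => gaussianReal_mul_const (hlaw i) (y i)
    refine Measure.ext_of_charFun ?_
    rw [(hindep.comp (fun i x => x * y i) fun _ => by fun_prop).charFun_map_fun_sum_eq_prod
      fun i => (hlaw_mul i).aemeasurable]
    ext t
    simp only [Finset.prod_apply, (hlaw_mul _).map_eq, charFun_gaussianReal,
      ← Complex.exp_sum]
    simp [mul_comm, Finset.mul_sum, Finset.sum_div, Finset.sum_neg_distrib]

lemma measureReal_le_sum_mul_le_exp (hindep : iIndepFun X μ)
    (hlaw : ∀ i, HasLaw (X i) (gaussianReal 0 (s i)) μ) (y : ι → ℝ) {r : ℝ} (hr : 0 ≤ r) :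
    μ.real {ω | r ≤ ∑ i, X i ω * y i} ≤ Real.exp (-r ^ 2 / (2 * ∑ i, s i * y i ^ 2)) := by
  have hsum := hasLaw_sum_mul_gaussianReal hindep hlaw y
  have hsub : HasSubgaussianMGF (fun ω => ∑ i, X i ω * y i) (∑ i, s i * ‖y i‖₊ ^ 2) μ :=
    { integrable_exp_mul t := by
        have hint := integrable_exp_mul_gaussianReal (μ := 0) (v := ∑ i, s i * ‖y i‖₊ ^ 2) t
        rw [← hsum.map_eq] at hint
        exact hint.comp_aemeasurable hsum.aemeasurable
      mgf_le t := by simp [mgf_gaussianReal hsum.map_eq] }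
  simpa using hsub.measure_ge_le hr

lemma integrable_exp_mul_sum_sq (hindep : iIndepFun X μ) (hX : ∀ i, Measurable (X i))
    (hlaw : ∀ i, HasLaw (X i) (gaussianReal 0 (s i)) μ) {t : ℝ} (ht : ∀ i, t * s i ≤ 1 / 4) :
    Integrable (fun ω => Real.exp (t * ∑ i, X i ω ^ 2)) μ := by
  have := hindep.isProbabilityMeasure
  have hsq : iIndepFun (fun i ω => X i ω ^ 2) μ := hindep.comp _ fun _ => measurable_id.pow_const 2
  have hint := hsq.integrable_exp_mul_sum (t := t) (s := Finset.univ)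
    (fun i => (hX i).pow_const 2) fun i _ => by
      refine Integrable.comp_measurable (f := X i) (g := fun x => Real.exp (t * x ^ 2)) ?_ (hX i)
      rw [(hlaw i).map_eq]
      exact integrable_exp_mul_sq_gaussianReal (by linarith [ht i])
  simpa using hint

lemma mgf_sum_sq_le_exp (hindep : iIndepFun X μ) (hX : ∀ i, Measurable (X i))
    (hlaw : ∀ i, HasLaw (X i) (gaussianReal 0 (s i)) μ) {t : ℝ} (ht : ∀ i, t * s i ≤ 1 / 4) :
    mgf (fun ω => ∑ i, X i ω ^ 2) μ t ≤ Real.exp (∑ i, (t * s i + 4 * (t * s i) ^ 2)) := by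
  have hmgf : ∀ i, mgf (fun ω => X i ω ^ 2) μ t ≤ Real.exp (t * s i + 4 * (t * s i) ^ 2) := by
    intro i
    change mgf ((fun x => x ^ 2) ∘ X i) μ t ≤ _
    rw [← mgf_map (hX i).aemeasurable (by fun_prop),
      (hlaw i).map_eq, mgf_sq_gaussianReal (by linarith [ht i]), mul_assoc]
    exact inv_sqrt_one_sub_two_mul_le_exp (ht i)
  have hsq : iIndepFun (fun i ω => X i ω ^ 2) μ := hindep.comp _ fun _ => measurable_id.pow_const 2
  calc mgf (fun ω => ∑ i, X i ω ^ 2) μ t = ∏ i, mgf (fun ω => X i ω ^ 2) μ t := by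
        rw [← hsq.mgf_sum fun i => (hX i).pow_const 2]
        congr 1
        ext ω
        simp
    _ ≤ ∏ i, Real.exp (t * s i + 4 * (t * s i) ^ 2) :=
        Finset.prod_le_prod (fun _ _ => mgf_nonneg) fun i _ => hmgf i
    _ = _ := (Real.exp_sum _ _).symm

lemma measureReal_le_sum_sq_le_exp (hindep : iIndepFun X μ) (hX : ∀ i, Measurable (X i))
    (hlaw : ∀ i, HasLaw (X i) (gaussianReal 0 (s i)) μ) {δ v : ℝ} (hδ₀ : 0 ≤ δ) (hδ₂ : δ ≤ 2)
    (hv : 0 < v) (hs : ∀ i, s i ≤ v) :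
    μ.real {ω | (1 + δ) * (Fintype.card ι * v) ≤ ∑ i, X i ω ^ 2}
      ≤ Real.exp (-(δ ^ 2 / 16 * Fintype.card ι)) := by
  have := hindep.isProbabilityMeasure
  set t := δ / (8 * v) with ht_def
  have htv : t * v = δ / 8 := by rw [ht_def]; field_simp
  have hts : ∀ i, t * s i ≤ δ / 8 := fun i => htv ▸ mul_le_mul_of_nonneg_left (hs i) (by positivity)
  have ht : ∀ i, t * s i ≤ 1 / 4 := fun i => (hts i).trans (by linarith)
  calc μ.real {ω | (1 + δ) * (Fintype.card ι * v) ≤ ∑ i, X i ω ^ 2}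
      ≤ Real.exp (-t * ((1 + δ) * (Fintype.card ι * v))) * mgf (fun ω => ∑ i, X i ω ^ 2) μ t :=
        measure_ge_le_exp_mul_mgf _ (by positivity) (integrable_exp_mul_sum_sq hindep hX hlaw ht)
    _ ≤ Real.exp (-t * ((1 + δ) * (Fintype.card ι * v)))
          * Real.exp (∑ _ : ι, (δ / 8 + 4 * (δ / 8) ^ 2)) := by
        gcongr
        refine (mgf_sum_sq_le_exp hindep hX hlaw ht).trans (Real.exp_le_exp.mpr ?_)
        gcongr <;> exact hts _
    _ = Real.exp (-(δ ^ 2 / 16 * Fintype.card ι)) := by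
        rw [← Real.exp_add, Finset.sum_const, Finset.card_univ, nsmul_eq_mul]
        congr 1
        linear_combination -(1 + δ) * Fintype.card ι * htv

lemma measureReal_sum_sq_le_le_exp {v : ℝ≥0} (hindep : iIndepFun X μ) (hX : ∀ i, Measurable (X i))
    (hlaw : ∀ i, HasLaw (X i) (gaussianReal 0 v) μ) {δ : ℝ} (hδ₀ : 0 ≤ δ) (hv : 0 < v) :
    μ.real {ω | ∑ i, X i ω ^ 2 ≤ (1 - δ) * (Fintype.card ι * v)}
      ≤ Real.exp (-(δ ^ 2 / 16 * Fintype.card ι)) := by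
  have := hindep.isProbabilityMeasure
  have : 0 < (v : ℝ) := hv
  set t := -(δ / (8 * v)) with ht_def
  have htv : t * v = -(δ / 8) := by rw [ht_def]; field_simp
  have ht : ∀ _ : ι, t * v ≤ 1 / 4 := fun _ => by linarith
  calc μ.real {ω | ∑ i, X i ω ^ 2 ≤ (1 - δ) * (Fintype.card ι * v)}
      ≤ Real.exp (-t * ((1 - δ) * (Fintype.card ι * v))) * mgf (fun ω => ∑ i, X i ω ^ 2) μ t :=
        measure_le_le_exp_mul_mgf _ (neg_nonpos.mpr (by positivity))
          (integrable_exp_mul_sum_sq hindep hX hlaw ht)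
    _ ≤ Real.exp (-t * ((1 - δ) * (Fintype.card ι * v)))
          * Real.exp (∑ _ : ι, (t * v + 4 * (t * v) ^ 2)) := by
        gcongr
        exact mgf_sum_sq_le_exp hindep hX hlaw ht
    _ = Real.exp (-(δ ^ 2 / 16 * Fintype.card ι)) := by
        rw [← Real.exp_add, Finset.sum_const, Finset.card_univ, nsmul_eq_mul, htv]
        congr 1
        linear_combination -(1 - δ) * Fintype.card ι * htv

end GaussianSums

/-! ### Matrix norms and stable rank -/

section MatrixNorms

variable {a b m : ℕ}

lemma colNorm_nonneg (M : Matrix (Fin a) (Fin b) ℝ) (t : Fin b) : 0 ≤ colNorm M t :=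
  Real.sqrt_nonneg _

lemma colNorm_sq (M : Matrix (Fin a) (Fin b) ℝ) (t : Fin b) :
    colNorm M t ^ 2 = ∑ i, M i t ^ 2 :=
  Real.sq_sqrt (Finset.sum_nonneg fun _ _ => sq_nonneg _)

lemma colNorm_eq_norm_mulVec_single (M : Matrix (Fin a) (Fin b) ℝ) (t : Fin b) :
    colNorm M t = ‖WithLp.toLp 2 (M.mulVec (Pi.single t 1))‖ := by
  simp [EuclideanSpace.norm_eq, colNorm]

lemma frobSq_eq_sum_colNorm_sq (M : Matrix (Fin a) (Fin b) ℝ) :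
    frobSq M = ∑ t, colNorm M t ^ 2 := by
  simp_rw [colNorm_sq, frobSq]
  exact Finset.sum_comm

lemma frobSq_nonneg (M : Matrix (Fin a) (Fin b) ℝ) : 0 ≤ frobSq M :=
  Finset.sum_nonneg fun _ _ => Finset.sum_nonneg fun _ _ => sq_nonneg _

lemma stableRank_nonneg (M : Matrix (Fin a) (Fin b) ℝ) : 0 ≤ stableRank M :=
  div_nonneg (frobSq_nonneg M) (sq_nonneg _)

open scoped Matrix.Norms.L2Operator in
lemma opNorm_nonneg (M : Matrix (Fin a) (Fin b) ℝ) : 0 ≤ opNorm M :=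
  norm_nonneg M

open scoped Matrix.Norms.L2Operator in
lemma opNorm_eq_zero {M : Matrix (Fin a) (Fin b) ℝ} : opNorm M = 0 ↔ M = 0 :=
  norm_eq_zero

open scoped Matrix.Norms.L2Operator in
lemma opNorm_mul_le (M : Matrix (Fin a) (Fin b) ℝ) (N : Matrix (Fin b) (Fin m) ℝ) :
    opNorm (M * N) ≤ opNorm M * opNorm N :=
  Matrix.l2_opNorm_mul M N

open scoped Matrix.Norms.L2Operator in
lemma opNorm_diagonal_le {c : ℝ} (hc : 0 ≤ c) {D : Fin b → ℝ} (hD : ∀ t, |D t| ≤ c) :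
    opNorm (Matrix.diagonal D) ≤ c :=
  (Matrix.l2_opNorm_diagonal D).le.trans ((pi_norm_le_iff_of_nonneg hc).mpr hD)

open scoped Matrix.Norms.L2Operator in
lemma norm_mulVec_le (M : Matrix (Fin a) (Fin b) ℝ) (w : EuclideanSpace ℝ (Fin b)) :
    ‖WithLp.toLp 2 (M.mulVec w)‖ ≤ opNorm M * ‖w‖ :=
  Matrix.l2_opNorm_mulVec M w

open scoped Matrix.Norms.L2Operator in
lemma exists_opNorm_le_norm_mulVec (M : Matrix (Fin a) (Fin b) ℝ) :
    ∃ w : EuclideanSpace ℝ (Fin b), ‖w‖ ≤ 1 ∧ opNorm M ≤ ‖WithLp.toLp 2 (M.mulVec w)‖ := by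
  have hcont : Continuous fun w : EuclideanSpace ℝ (Fin b) => ‖WithLp.toLp 2 (M.mulVec w)‖ :=
    continuous_norm.comp ((PiLp.continuous_toLp 2 _).comp
      (Continuous.matrix_mulVec continuous_const (PiLp.continuous_ofLp 2 _)))
  obtain ⟨w, hw, hmax⟩ := (isCompact_closedBall (0 : EuclideanSpace ℝ (Fin b)) 1).exists_isMaxOn
    ⟨0, by simp⟩ hcont.continuousOn
  refine ⟨w, by simpa using hw, ?_⟩
  rw [opNorm, Matrix.l2_opNorm_def]
  exact ContinuousLinearMap.opNorm_le_of_unit_norm (norm_nonneg _) fun x hx =>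
    hmax (by simp [hx])

/-- Test the operator norm on the indicator of `T`. -/
lemma card_mul_sq_le_opNorm_sq {M : Matrix (Fin a) (Fin b) ℝ} {T : Finset (Fin b)} {x : Fin a → ℝ}
    (hT : ∀ t ∈ T, ∀ i, M i t = x i) : (T.card : ℝ) * ∑ i, x i ^ 2 ≤ opNorm M ^ 2 := by
  rcases T.eq_empty_or_nonempty with rfl | hne
  · simpa using sq_nonneg _
  have hcard : 0 < (T.card : ℝ) := by exact_mod_cast hne.card_pos
  let w : EuclideanSpace ℝ (Fin b) := WithLp.toLp 2 fun t => if t ∈ T then 1 else 0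
  have hw : ‖w‖ ^ 2 = T.card := by simp [w, EuclideanSpace.real_norm_sq_eq]
  have himage : ‖WithLp.toLp 2 (M.mulVec w)‖ ^ 2 = T.card * (T.card * ∑ i, x i ^ 2) := by
    have hrow : ∀ i, M.mulVec w i = T.card * x i := fun i => by
      simp only [w, Matrix.mulVec, dotProduct, mul_ite, mul_one, mul_zero, Finset.sum_ite_mem,
        Finset.univ_inter]
      rw [Finset.sum_congr rfl fun t ht => hT t ht i, Finset.sum_const, nsmul_eq_mul]
    simp only [EuclideanSpace.real_norm_sq_eq, hrow, mul_pow, ← Finset.mul_sum]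
    ring
  refine le_of_mul_le_mul_left ?_ hcard
  calc (T.card : ℝ) * (T.card * ∑ i, x i ^ 2) ≤ (opNorm M * ‖w‖) ^ 2 :=
        himage ▸ pow_le_pow_left₀ (norm_nonneg _) (norm_mulVec_le M w) 2
    _ = T.card * opNorm M ^ 2 := by rw [mul_pow, hw, mul_comm]

lemma stableRank_le_of_frobSq_le {M : Matrix (Fin a) (Fin b) ℝ} {F s r : ℝ} (hF : frobSq M ≤ F)
    (hs : 0 < s) (hop : s ≤ opNorm M ^ 2) (hr₀ : 0 ≤ r) (hr : F ≤ r * s) : stableRank M ≤ r := by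
  rw [stableRank, div_le_iff₀ (hs.trans_le hop)]
  exact hF.trans (hr.trans (by gcongr))

lemma frobSq_le_mul_opNorm_sq {M : Matrix (Fin a) (Fin b) ℝ} {s : ℝ} (h : stableRank M ≤ s) :
    frobSq M ≤ s * opNorm M ^ 2 := by
  rcases eq_or_ne M 0 with rfl | hM
  · simp [frobSq, opNorm_eq_zero.mpr]
  · exact (div_le_iff₀ (pow_pos ((opNorm_nonneg M).lt_of_ne' (mt opNorm_eq_zero.mp hM)) 2)).mp h

end MatrixNorms

section RMSNorm

variable {d n : ℕ} {X : Matrix (Fin d) (Fin n) ℝ}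

lemma colNorm_rmsNorm {t : Fin n} (h : colNorm X t ≠ 0) : colNorm (rmsNorm X) t = √(d : ℝ) := by
  have hsq : ∑ i, rmsNorm X i t ^ 2 = d := by
    simp_rw [rmsNorm, Matrix.of_apply, mul_pow, div_pow, ← Finset.mul_sum, ← Finset.sum_div,
      ← colNorm_sq]
    rw [div_self (pow_ne_zero _ h), Real.sq_sqrt (Nat.cast_nonneg _), mul_one]
  rw [colNorm, hsq]

lemma colNorm_rmsNorm_sq_le (X : Matrix (Fin d) (Fin n) ℝ) (t : Fin n) :
    colNorm (rmsNorm X) t ^ 2 ≤ d := by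
  by_cases h : colNorm X t = 0
  · simp [colNorm_sq, rmsNorm, h]
  · rw [colNorm_rmsNorm h, Real.sq_sqrt (Nat.cast_nonneg _)]

lemma frobSq_rmsNorm_le (X : Matrix (Fin d) (Fin n) ℝ) : frobSq (rmsNorm X) ≤ n * d := by
  rw [frobSq_eq_sum_colNorm_sq]
  exact (Finset.sum_le_sum fun t _ => colNorm_rmsNorm_sq_le X t).trans (by simp)

lemma frobSq_rmsNorm (h : ∀ t, colNorm X t ≠ 0) : frobSq (rmsNorm X) = n * d := by
  simp [frobSq_eq_sum_colNorm_sq, colNorm_rmsNorm (h _)]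

lemma rmsNorm_mul_diagonal (X : Matrix (Fin d) (Fin n) ℝ) :
    rmsNorm X * Matrix.diagonal (fun t => colNorm X t / √(d : ℝ)) = X := by
  ext i t
  rw [Matrix.mul_diagonal, rmsNorm, Matrix.of_apply]
  by_cases h : colNorm X t = 0
  · have hsum : ∑ j, X j t ^ 2 = 0 := by simp [← colNorm_sq, h]
    have hi := (Finset.sum_eq_zero_iff_of_nonneg fun _ _ => sq_nonneg _).mp hsum i
      (Finset.mem_univ i)
    simp [h, eq_zero_of_pow_eq_zero hi]
  · have hd : √(d : ℝ) ≠ 0 := (Real.sqrt_pos.mpr (by exact_mod_cast i.pos)).ne'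
    field_simp

lemma opNorm_sq_le_mul_opNorm_rmsNorm_sq {R : ℝ} (hR : 0 ≤ R)
    (hX : ∀ t, colNorm X t ^ 2 ≤ R * d) : opNorm X ^ 2 ≤ R * opNorm (rmsNorm X) ^ 2 := by
  have hdiag : opNorm (Matrix.diagonal fun t => colNorm X t / √(d : ℝ)) ≤ √R :=
    opNorm_diagonal_le (Real.sqrt_nonneg _) fun t => by
      rw [abs_of_nonneg (div_nonneg (colNorm_nonneg _ _) (Real.sqrt_nonneg _))]
      refine div_le_of_le_mul₀ (Real.sqrt_nonneg _) (Real.sqrt_nonneg _) ?_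
      rw [← Real.sqrt_mul hR]
      exact Real.le_sqrt_of_sq_le (hX t)
  calc opNorm X ^ 2 ≤ (opNorm (rmsNorm X) * √R) ^ 2 := by
        refine pow_le_pow_left₀ (opNorm_nonneg X) ?_ 2
        conv_lhs => rw [← rmsNorm_mul_diagonal X]
        exact (opNorm_mul_le _ _).trans (mul_le_mul_of_nonneg_left hdiag (opNorm_nonneg _))
    _ = R * opNorm (rmsNorm X) ^ 2 := by rw [mul_pow, Real.sq_sqrt hR, mul_comm]

lemma stableRank_rmsNorm_le {R s r : ℝ} (hR : 0 < R) (hs : 0 < s)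
    (hX : ∀ t, colNorm X t ^ 2 ≤ R * d) (hop : s ≤ opNorm X ^ 2) (hr₀ : 0 ≤ r)
    (hr : n * d * R ≤ r * s) : stableRank (rmsNorm X) ≤ r := by
  have h := opNorm_sq_le_mul_opNorm_rmsNorm_sq hR.le hX
  refine stableRank_le_of_frobSq_le (s := s / R) (frobSq_rmsNorm_le X) (by positivity) ?_ hr₀ ?_
  · rw [div_le_iff₀ hR]
    linarith
  · rwa [← mul_div_assoc, le_div_iff₀ hR]

end RMSNorm

/-! ### Measurability -/

section Measurability

variable {α : Type*} [MeasurableSpace α] {a b m : ℕ}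

lemma measurable_matrix_iff {ι κ : Type*} {f : α → Matrix ι κ ℝ} :
    Measurable f ↔ ∀ i j, Measurable fun x => f x i j :=
  measurable_pi_iff.trans (forall_congr' fun _ => measurable_pi_iff)

lemma measurable_matrix_apply {ι κ : Type*} {f : α → Matrix ι κ ℝ} (hf : Measurable f) (i : ι)
    (j : κ) : Measurable fun x => f x i j :=
  measurable_matrix_iff.mp hf i j

@[fun_prop]
lemma measurable_matrix_mul {f : α → Matrix (Fin a) (Fin b) ℝ} {g : α → Matrix (Fin b) (Fin m) ℝ}
    (hf : Measurable f) (hg : Measurable g) : Measurable fun x => f x * g x := by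
  simp only [measurable_matrix_iff, Matrix.mul_apply]
  fun_prop

@[fun_prop]
lemma measurable_matrix_add {f g : α → Matrix (Fin a) (Fin b) ℝ}
    (hf : Measurable f) (hg : Measurable g) : Measurable fun x => f x + g x := by
  simp only [measurable_matrix_iff, Matrix.add_apply]
  fun_prop

@[fun_prop]
lemma measurable_matrix_map {f : α → Matrix (Fin a) (Fin b) ℝ} {σ : ℝ → ℝ} (hf : Measurable f)
    (hσ : Measurable σ) : Measurable fun x => (f x).map σ :=
  measurable_matrix_iff.mpr fun i j => hσ.comp (measurable_matrix_apply hf i j)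

@[fun_prop]
lemma measurable_colNorm {f : α → Matrix (Fin a) (Fin b) ℝ} (hf : Measurable f) (t : Fin b) :
    Measurable fun x => colNorm (f x) t := by
  unfold colNorm
  fun_prop

@[fun_prop]
lemma measurable_rmsNorm {f : α → Matrix (Fin a) (Fin b) ℝ} (hf : Measurable f) :
    Measurable fun x => rmsNorm (f x) := by
  simp only [measurable_matrix_iff, rmsNorm, Matrix.of_apply]
  fun_prop

@[fun_prop]
lemma measurable_frobSq {f : α → Matrix (Fin a) (Fin b) ℝ} (hf : Measurable f) :
    Measurable fun x => frobSq (f x) := by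
  unfold frobSq
  fun_prop

@[fun_prop]
lemma measurable_opNorm {f : α → Matrix (Fin a) (Fin b) ℝ} (hf : Measurable f) :
    Measurable fun x => opNorm (f x) := by
  have hcont : Continuous (opNorm : Matrix (Fin a) (Fin b) ℝ → ℝ) := by
    open scoped Matrix.Norms.L2Operator in exact continuous_norm
  have hcont' : Continuous fun M : Fin a → Fin b → ℝ => opNorm (Matrix.of M) := hcont
  exact hcont'.measurable.comp hf

@[fun_prop]
lemma measurable_stableRank {f : α → Matrix (Fin a) (Fin b) ℝ} (hf : Measurable f) :
    Measurable fun x => stableRank (f x) := by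
  unfold stableRank
  fun_prop

end Measurability

/-! ### Gaussian matrices -/

/-- The norm `r` of a sum of two vectors of norms `p` and `q` that are almost orthogonal, the second
norm being only approximately equal to `q`; `δ` measures both defects. -/
def NearPythagorean (δ p q r : ℝ) : Prop :=
  (1 - 2 * δ) * (p ^ 2 + q ^ 2) ≤ r ^ 2 ∧ r ^ 2 ≤ p ^ 2 + 2 * δ * (p * q) + (1 + δ) * q ^ 2

lemma nearPythagorean_norm_add {F : Type*} [NormedAddCommGroup F] [InnerProductSpace ℝ F] {y g : F}
    {δ q : ℝ} (hδ : 0 ≤ δ) (hlower : (1 - δ) * q ^ 2 ≤ ‖g‖ ^ 2)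
    (hupper : ‖g‖ ^ 2 ≤ (1 + δ) * q ^ 2) (hinner : |inner ℝ y g| ≤ δ * (‖y‖ * q)) :
    NearPythagorean δ ‖y‖ q ‖y + g‖ := by
  obtain ⟨hinner₁, hinner₂⟩ := abs_le.mp hinner
  rw [NearPythagorean, norm_add_sq_real]
  constructor
  · nlinarith [mul_nonneg hδ (sq_nonneg (‖y‖ - q)), mul_nonneg hδ (sq_nonneg ‖y‖)]
  · linarith

section GaussianVector

variable {ι Ω : Type*} [Fintype ι] [MeasurableSpace Ω] {μ : Measure Ω} {X : ι → Ω → ℝ} {v : ℝ≥0}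
  {δ : ℝ}

lemma measureReal_lt_inner_le_exp (hindep : iIndepFun X μ)
    (hlaw : ∀ i, HasLaw (X i) (gaussianReal 0 v) μ) (hδ : 0 ≤ δ) (hv : 0 < v)
    (y : EuclideanSpace ℝ ι) :
    μ.real {ω | δ * (‖y‖ * √(Fintype.card ι * v)) < inner ℝ y (WithLp.toLp 2 fun i => X i ω)}
      ≤ Real.exp (-(δ ^ 2 / 16 * Fintype.card ι)) := by
  have := hindep.isProbabilityMeasure
  rcases eq_or_ne y 0 with rfl | hy
  · simp [Real.exp_nonneg]
  have : 0 < ‖y‖ := norm_pos_iff.mpr hy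
  refine (measureReal_mono fun ω hω => ?_).trans ((measureReal_le_sum_mul_le_exp hindep hlaw y
    (r := δ * (‖y‖ * √(Fintype.card ι * v))) (by positivity)).trans (Real.exp_le_exp.mpr ?_))
  · simpa only [PiLp.inner_apply, RCLike.inner_apply, conj_trivial]
      using (Set.mem_ofPred_eq ▸ hω).le
  rw [← Finset.mul_sum, ← EuclideanSpace.real_norm_sq_eq, mul_pow, mul_pow,
    Real.sq_sqrt (by positivity)]
  have hcancel : -(δ ^ 2 * (‖y‖ ^ 2 * (Fintype.card ι * v))) / (2 * (v * ‖y‖ ^ 2))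
      = -(δ ^ 2 / 2 * Fintype.card ι) := by
    field_simp
  rw [hcancel]
  gcongr
  norm_num

lemma measureReal_not_nearPythagorean_add_le (hindep : iIndepFun X μ) (hX : ∀ i, Measurable (X i))
    (hlaw : ∀ i, HasLaw (X i) (gaussianReal 0 v) μ) (hδ₀ : 0 ≤ δ) (hδ₂ : δ ≤ 2) (hv : 0 < v)
    (y : EuclideanSpace ℝ ι) :
    μ.real {ω | ¬ NearPythagorean δ ‖y‖ √(Fintype.card ι * v)
        ‖y + WithLp.toLp 2 fun i => X i ω‖}
      ≤ 4 * Real.exp (-(δ ^ 2 / 16 * Fintype.card ι)) := by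
  have := hindep.isProbabilityMeasure
  set q : ℝ := √(Fintype.card ι * v)
  have hq : q ^ 2 = Fintype.card ι * v := Real.sq_sqrt (by positivity)
  let g : Ω → EuclideanSpace ℝ ι := fun ω => WithLp.toLp 2 fun i => X i ω
  have hg : ∀ ω, ‖g ω‖ ^ 2 = ∑ i, X i ω ^ 2 := fun ω => EuclideanSpace.real_norm_sq_eq _
  have hsub : {ω | ¬ NearPythagorean δ ‖y‖ q ‖y + g ω‖} ⊆
      ({ω | (1 + δ) * (Fintype.card ι * v) ≤ ∑ i, X i ω ^ 2} ∪
        {ω | ∑ i, X i ω ^ 2 ≤ (1 - δ) * (Fintype.card ι * v)}) ∪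
      ({ω | δ * (‖y‖ * q) < inner ℝ y (g ω)} ∪ {ω | δ * (‖-y‖ * q) < inner ℝ (-y) (g ω)}) := by
    intro ω hω
    contrapose! hω
    simp only [Set.mem_union, Set.mem_ofPred_eq, not_or, not_le, not_lt, norm_neg,
      inner_neg_left, ← hg, ← hq] at hω
    obtain ⟨⟨hupper, hlower⟩, hinner, hinner_neg⟩ := hω
    exact not_not.mpr (nearPythagorean_norm_add hδ₀ hlower.le hupper.le
      (abs_le.mpr ⟨by linarith, hinner⟩))
  have hupper := measureReal_le_sum_sq_le_exp hindep hX hlaw hδ₀ hδ₂ hv fun _ => le_rfl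
  have hlower := measureReal_sum_sq_le_le_exp hindep hX hlaw hδ₀ hv
  have hinner := measureReal_lt_inner_le_exp hindep hlaw hδ₀ hv y
  have hinner_neg := measureReal_lt_inner_le_exp hindep hlaw hδ₀ hv (-y)
  calc _ ≤ _ := (measureReal_mono hsub).trans (measureReal_union_le _ _)
    _ ≤ _ := add_le_add
        ((measureReal_union_le _ _).trans (add_le_add hupper hlower))
        ((measureReal_union_le _ _).trans (add_le_add hinner hinner_neg))
    _ = _ := by ring

end GaussianVector

instance isProbabilityMeasure_gaussianMatrix (a b : ℕ) (v : ℝ≥0) :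
    IsProbabilityMeasure (gaussianMatrix a b v) :=
  inferInstanceAs (IsProbabilityMeasure (α := Fin a → Fin b → ℝ)
    (Measure.pi fun _ => Measure.pi fun _ => gaussianReal 0 v))

lemma iIndepFun_comp_measurePreserving {Ω Ω' ι : Type*} {β : ι → Type*} [MeasurableSpace Ω]
    [MeasurableSpace Ω'] [∀ i, MeasurableSpace (β i)] {μ : Measure Ω} {ν : Measure Ω'} {f : Ω → Ω'}
    {Y : ∀ i, Ω' → β i} (hY : iIndepFun Y ν) (hmeas : ∀ i, Measurable (Y i))
    (hf : MeasurePreserving f μ ν) : iIndepFun (fun i ω => Y i (f ω)) μ := by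
  rw [iIndepFun_iff_measure_inter_preimage_eq_mul] at hY ⊢
  intro S s hs
  have hmeas_pre : ∀ i ∈ S, MeasurableSet (Y i ⁻¹' s i) := fun i hi => hmeas i (hs i hi)
  have h := hY S hs
  rw [← hf.measure_preimage (S.measurableSet_biInter hmeas_pre).nullMeasurableSet,
    Set.preimage_iInter₂] at h
  exact h.trans (Finset.prod_congr rfl fun i hi =>
    (hf.measure_preimage (hmeas_pre i hi).nullMeasurableSet).symm)

section GaussianMatrix

variable {a b n : ℕ} {v : ℝ≥0} {δ : ℝ}

lemma hasLaw_mulVec_gaussianMatrix (a : ℕ) (v : ℝ≥0) (z : EuclideanSpace ℝ (Fin b)) (i : Fin a) :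
    HasLaw (fun G => G.mulVec z i) (gaussianReal 0 (v * ‖z‖₊ ^ 2)) (gaussianMatrix a b v) := by
  have hrow : HasLaw (fun x : Fin b → ℝ => ∑ j, x j * z j) (gaussianReal 0 (v * ‖z‖₊ ^ 2))
      (Measure.pi fun _ => gaussianReal 0 v) := by
    have h := hasLaw_sum_mul_gaussianReal (X := fun (j : Fin b) (x : Fin b → ℝ) => x j)
      (iIndepFun_pi fun _ => aemeasurable_id)
      (fun j => (measurePreserving_eval (fun _ => gaussianReal 0 v) j).hasLaw) z
    have hnorm : ‖z‖₊ ^ 2 = ∑ j, ‖z j‖₊ ^ 2 :=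
      NNReal.eq (by simpa using EuclideanSpace.norm_sq_eq z)
    rwa [← Finset.mul_sum, ← hnorm] at h
  exact hrow.fun_comp (measurePreserving_eval
    (fun _ : Fin a => Measure.pi fun _ : Fin b => gaussianReal 0 v) i).hasLaw

lemma iIndepFun_mulVec_gaussianMatrix (a : ℕ) (v : ℝ≥0) (z : Fin b → ℝ) :
    iIndepFun (fun i (G : Matrix (Fin a) (Fin b) ℝ) => G.mulVec z i) (gaussianMatrix a b v) :=
  iIndepFun_pi (μ := fun _ : Fin a => Measure.pi fun _ : Fin b => gaussianReal 0 v)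
    (X := fun _ x => ∑ j, x j * z j)
    fun _ => (by fun_prop : Measurable fun x : Fin b → ℝ => ∑ j, x j * z j).aemeasurable

@[fun_prop]
lemma measurable_mulVec (z : Fin b → ℝ) (i : Fin a) :
    Measurable fun G : Matrix (Fin a) (Fin b) ℝ => G.mulVec z i := by
  have : ∀ j, Measurable fun G : Matrix (Fin a) (Fin b) ℝ => G i j := fun j =>
    measurable_matrix_apply measurable_id i j
  unfold Matrix.mulVec dotProduct
  fun_prop

lemma measureReal_sum_mulVec_sq_le_exp (a : ℕ) (hv : 0 < v) (hδ₀ : 0 ≤ δ) (hδ₂ : δ ≤ 2)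
    {z : EuclideanSpace ℝ (Fin b)} {R : ℝ≥0} (hR : 0 < R) (hz : ‖z‖₊ ^ 2 ≤ R) :
    (gaussianMatrix a b v).real
        {G | (1 + δ) * (a * (v * R)) ≤ ∑ i, G.mulVec z i ^ 2}
      ≤ Real.exp (-(δ ^ 2 / 16 * a)) := by
  simpa using measureReal_le_sum_sq_le_exp (iIndepFun_mulVec_gaussianMatrix a v z)
    (measurable_mulVec _) (hasLaw_mulVec_gaussianMatrix a v z) hδ₀ hδ₂ (mul_pos hv hR)
    fun _ => mul_le_mul_right hz v

lemma measureReal_sum_sum_mulVec_sq_le_exp (a m : ℕ) (hv : 0 < v) (hδ₀ : 0 ≤ δ) (hδ₂ : δ ≤ 2)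
    {z : Fin m → EuclideanSpace ℝ (Fin b)} {R : ℝ≥0} (hR : 0 < R) (hz : ∀ h, ‖z h‖₊ ^ 2 ≤ R) :
    (Measure.pi fun _ : Fin m => gaussianMatrix a b v).real
        {G | (1 + δ) * ((m * a : ℕ) * (v * R)) ≤ ∑ h, ∑ i, (G h).mulVec (z h) i ^ 2}
      ≤ Real.exp (-(δ ^ 2 / 16 * (m * a : ℕ))) := by
  have hindep : iIndepFun (fun (p : Fin m × Fin a) (G : Fin m → Matrix (Fin a) (Fin b) ℝ) =>
      (G p.1).mulVec (z p.1) p.2) (Measure.pi fun _ => gaussianMatrix a b v) := by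
    refine iIndepFun_uncurry'
      (X := fun h i (G : Fin m → Matrix (Fin a) (Fin b) ℝ) => (G h).mulVec (z h) i)
      (fun h i => (measurable_mulVec (z h) i).comp (measurable_pi_apply h)) ?_ fun h => ?_
    · exact iIndepFun_pi (μ := fun _ : Fin m => gaussianMatrix a b v)
        (X := fun h G i => G.mulVec (z h) i)
        fun h => (measurable_pi_iff.mpr (measurable_mulVec (z h))).aemeasurable
    · exact iIndepFun_comp_measurePreserving (iIndepFun_mulVec_gaussianMatrix a v (z h))
        (measurable_mulVec _) (measurePreserving_eval _ h)
  simpa [Fintype.sum_prod_type] using measureReal_le_sum_sq_le_exp hindep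
    (fun p => (measurable_mulVec (z p.1) p.2).comp (measurable_pi_apply p.1))
    (fun p => (hasLaw_mulVec_gaussianMatrix a v (z p.1) p.2).fun_comp
      (measurePreserving_eval (fun _ : Fin m => gaussianMatrix a b v) p.1).hasLaw)
    hδ₀ hδ₂ (mul_pos hv hR) fun p => mul_le_mul_right (hz p.1) v

lemma measureReal_not_nearPythagorean_mulVec_le (hv : 0 < v) (hδ₀ : 0 ≤ δ) (hδ₂ : δ ≤ 2)
    (y : EuclideanSpace ℝ (Fin a)) (z : EuclideanSpace ℝ (Fin b)) :
    (gaussianMatrix a b v).real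
        {G | ¬ NearPythagorean δ ‖y‖ (√(a * v) * ‖z‖) ‖y + WithLp.toLp 2 (G.mulVec z)‖}
      ≤ 4 * Real.exp (-(δ ^ 2 / 16 * a)) := by
  rcases eq_or_ne z 0 with rfl | hz
  · have h : NearPythagorean δ ‖y‖ 0 ‖y‖ := ⟨by nlinarith [sq_nonneg ‖y‖], by simp⟩
    simpa [h] using Real.exp_nonneg _
  have hvar : 0 < v * ‖z‖₊ ^ 2 := mul_pos hv (pow_pos (nnnorm_pos.mpr hz) 2)
  have h := measureReal_not_nearPythagorean_add_le (iIndepFun_mulVec_gaussianMatrix a v z)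
    (measurable_mulVec _) (hasLaw_mulVec_gaussianMatrix a v z) hδ₀ hδ₂ hvar y
  have hsqrt : √(a * (v * ‖z‖ ^ 2)) = √(a * v) * ‖z‖ := by
    rw [← mul_assoc, Real.sqrt_mul (by positivity), Real.sqrt_sq (norm_nonneg z)]
  simpa [hsqrt] using h

/-- The effect of a Gaussian update `X' = Y + G * Z`, where `ρ` is the number of rows of `G` times
the variance of its entries: column norms obey an approximate Pythagorean theorem, and neither
summand is lost in the operator norm. -/
structure ResidualUpdate (δ ρ : ℝ) (Y : Matrix (Fin a) (Fin n) ℝ) (Z : Matrix (Fin b) (Fin n) ℝ)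
    (X' : Matrix (Fin a) (Fin n) ℝ) : Prop where
  colNorm : ∀ t, NearPythagorean δ (colNorm Y t) (√ρ * colNorm Z t) (colNorm X' t)
  opNorm_left : (1 - 2 * δ) * opNorm Y ^ 2 ≤ opNorm X' ^ 2
  opNorm_right : (1 - 2 * δ) * (ρ * opNorm Z ^ 2) ≤ opNorm X' ^ 2

/-- The operator norm of `Y + G * Z` is tested on maximizers for `Y` and for `Z`. -/
lemma exists_residualUpdate_of_nearPythagorean (hδ : δ ≤ 1 / 2) {ρ : ℝ} (hρ : 0 ≤ ρ)
    (Y : Matrix (Fin a) (Fin n) ℝ) (Z : Matrix (Fin b) (Fin n) ℝ) :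
    ∃ w : Fin n ⊕ Fin 2 → EuclideanSpace ℝ (Fin n), ∀ G : Matrix (Fin a) (Fin b) ℝ,
      (∀ i, NearPythagorean δ ‖WithLp.toLp 2 (Y.mulVec (w i))‖
        (√ρ * ‖WithLp.toLp 2 (Z.mulVec (w i))‖)
        ‖WithLp.toLp 2 (Y.mulVec (w i)) + WithLp.toLp 2 (G.mulVec (Z.mulVec (w i)))‖) →
      ResidualUpdate δ ρ Y Z (Y + G * Z) := by
  obtain ⟨wY, hwY, hY⟩ := exists_opNorm_le_norm_mulVec Y
  obtain ⟨wZ, hwZ, hZ⟩ := exists_opNorm_le_norm_mulVec Z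
  refine ⟨Sum.elim (fun t => WithLp.toLp 2 (Pi.single t 1)) ![wY, wZ], fun G h => ?_⟩
  have hadd : ∀ w : Fin n → ℝ, WithLp.toLp 2 (Y.mulVec w) + WithLp.toLp 2 (G.mulVec (Z.mulVec w))
      = WithLp.toLp 2 ((Y + G * Z).mulVec w) := fun w => by
    rw [Matrix.add_mulVec, ← Matrix.mulVec_mulVec, WithLp.toLp_add]
  have htest : ∀ w : EuclideanSpace ℝ (Fin n), ‖w‖ ≤ 1 →
      ‖WithLp.toLp 2 ((Y + G * Z).mulVec w)‖ ^ 2 ≤ opNorm (Y + G * Z) ^ 2 := fun w hw =>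
    pow_le_pow_left₀ (norm_nonneg _) ((norm_mulVec_le _ w).trans
      (mul_le_of_le_one_right (opNorm_nonneg _) hw)) 2
  simp only [hadd] at h
  constructor
  · intro t
    simpa only [colNorm_eq_norm_mulVec_single, Sum.elim_inl] using h (Sum.inl t)
  · refine le_trans ?_ ((h (Sum.inr 0)).1.trans (htest wY hwY))
    gcongr
    · linarith
    · exact (pow_le_pow_left₀ (opNorm_nonneg Y) hY 2).trans
        (le_add_of_nonneg_right (sq_nonneg _))
  · refine le_trans ?_ ((h (Sum.inr 1)).1.trans (htest wZ hwZ))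
    gcongr
    · linarith
    · rw [Sum.elim_inr, mul_pow, Real.sq_sqrt hρ]
      exact (mul_le_mul_of_nonneg_left (pow_le_pow_left₀ (opNorm_nonneg Z) hZ 2) hρ).trans
        (le_add_of_nonneg_left (sq_nonneg _))

lemma measureReal_not_residualUpdate_le (hv : 0 < v) (hδ₀ : 0 ≤ δ) (hδ₁ : δ ≤ 1 / 2)
    (Y : Matrix (Fin a) (Fin n) ℝ) (Z : Matrix (Fin b) (Fin n) ℝ) :
    (gaussianMatrix a b v).real {G | ¬ ResidualUpdate δ (a * v) Y Z (Y + G * Z)}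
      ≤ (n + 2) * (4 * Real.exp (-(δ ^ 2 / 16 * a))) := by
  obtain ⟨w, hw⟩ := exists_residualUpdate_of_nearPythagorean hδ₁ (ρ := a * v) (by positivity) Y Z
  refine (measureReal_mono fun G hG => mt (hw G) hG).trans <| (measureReal_not_forall_le fun i =>
    measureReal_not_nearPythagorean_mulVec_le hv hδ₀ (by linarith) _ _).trans_eq ?_
  rw [Fintype.card_sum, Fintype.card_fin, Fintype.card_fin]
  push_cast
  rfl

end GaussianMatrix

/-! ### One layer -/

section ResidualUpdate

variable {a b n : ℕ} {δ ρ : ℝ}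

lemma residualUpdate_iff {Y X' : Matrix (Fin a) (Fin n) ℝ} {Z : Matrix (Fin b) (Fin n) ℝ} :
    ResidualUpdate δ ρ Y Z X' ↔
      (∀ t, NearPythagorean δ (colNorm Y t) (√ρ * colNorm Z t) (colNorm X' t)) ∧
        (1 - 2 * δ) * opNorm Y ^ 2 ≤ opNorm X' ^ 2 ∧
        (1 - 2 * δ) * (ρ * opNorm Z ^ 2) ≤ opNorm X' ^ 2 :=
  ⟨fun h => ⟨h.colNorm, h.opNorm_left, h.opNorm_right⟩, fun h => ⟨h.1, h.2.1, h.2.2⟩⟩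

lemma measurableSet_residualUpdate {α : Type*} [MeasurableSpace α]
    {Y X' : α → Matrix (Fin a) (Fin n) ℝ} {Z : α → Matrix (Fin b) (Fin n) ℝ} (hY : Measurable Y)
    (hZ : Measurable Z) (hX' : Measurable X') (δ ρ : ℝ) :
    MeasurableSet {x | ResidualUpdate δ ρ (Y x) (Z x) (X' x)} := by
  simp only [residualUpdate_iff, NearPythagorean, measurableSet_setOfPred]
  refine .and (.forall fun t => .and ?_ ?_) (.and ?_ ?_) <;>
    exact measurableSet_setOfPred.mp (measurableSet_le (by fun_prop) (by fun_prop))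

lemma ResidualUpdate.colNorm_ne_zero {Y X' : Matrix (Fin a) (Fin n) ℝ}
    {Z : Matrix (Fin b) (Fin n) ℝ} (h : ResidualUpdate δ ρ Y Z X') (hδ : δ < 1 / 2) {t : Fin n}
    (hY : MSITransformer.colNorm Y t ≠ 0) : MSITransformer.colNorm X' t ≠ 0 := by
  intro hX'
  have hlower := (h.colNorm t).1
  rw [hX'] at hlower
  have hpos : 0 < (1 - 2 * δ) *
      (MSITransformer.colNorm Y t ^ 2 + (√ρ * MSITransformer.colNorm Z t) ^ 2) :=
    mul_pos (by linarith) (by positivity)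
  linarith

end ResidualUpdate

lemma colNorm_concatHeads_sq {d nHead dHead n : ℕ} (hd : d = nHead * dHead)
    (H : Fin nHead → Matrix (Fin dHead) (Fin n) ℝ) (t : Fin n) :
    colNorm (concatHeads hd H) t ^ 2 = ∑ h, ∑ r, H h r t ^ 2 := by
  rw [colNorm_sq, ← Fintype.sum_prod_type' (fun h r => H h r t ^ 2)]
  exact Fintype.sum_equiv ((finCongr hd).trans finProdFinEquiv.symm) _ _ fun _ => rfl

/-- Jensen's inequality: the columns of `A * P` are averages of those of `A`. -/
lemma colNorm_mul_columnStochastic_sq_le {d n : ℕ} {A : Matrix (Fin d) (Fin n) ℝ} {c : ℝ}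
    (hA : ∀ t, colNorm A t ^ 2 ≤ c) {P : Matrix (Fin n) (Fin n) ℝ} (hP : ColumnStochastic P)
    (t : Fin n) : colNorm (A * P) t ^ 2 ≤ c := by
  have hjensen : ∀ j, (A * P) j t ^ 2 ≤ ∑ s, P s t * A j s ^ 2 := fun j => by
    have h := (even_two.convexOn_pow (𝕜 := ℝ)).map_sum_le (t := Finset.univ)
      (w := fun s => P s t) (p := fun s => A j s) (fun s _ => hP.1 s t) (hP.2 t)
      (fun _ _ => Set.mem_univ _)
    simpa only [Matrix.mul_apply, smul_eq_mul, mul_comm] using h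
  calc colNorm (A * P) t ^ 2 ≤ ∑ j, ∑ s, P s t * A j s ^ 2 := by
        rw [colNorm_sq]
        exact Finset.sum_le_sum fun j _ => hjensen j
    _ = ∑ s, P s t * colNorm A s ^ 2 := by
        rw [Finset.sum_comm]
        simp_rw [colNorm_sq, Finset.mul_sum]
    _ ≤ ∑ s, P s t * c := Finset.sum_le_sum fun s _ =>
        mul_le_mul_of_nonneg_left (hA s) (hP.1 s t)
    _ = c := by rw [← Finset.sum_mul, hP.2 t, one_mul]

lemma MeanSpike.abs_le {σ : ℝ → ℝ} {stσ pσ : ℝ} {Psucc : ℕ → ℕ → ℕ → ℝ}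
    (h : MeanSpike σ stσ pσ Psucc) (x : ℝ) : |σ x| ≤ |x| := by
  simpa [h.map_zero] using h.lipschitz.dist_le_mul x 0

namespace Layer

variable {d nHead dHead k n : ℕ}

/-- The concatenated head outputs, so that `X^att = X + W_O * heads`. -/
def heads (θ : Layer d nHead dHead k n) (hd : d = nHead * dHead) (X : Matrix (Fin d) (Fin n) ℝ) :
    Matrix (Fin d) (Fin n) ℝ :=
  concatHeads hd fun h => θ.WV h * (rmsNorm X * θ.P h)

/-- The layer with the given mixing matrices and Gaussian weights. -/
def ofWeights (P : Fin nHead → Matrix (Fin n) (Fin n) ℝ) (w : WeightSpace d nHead dHead k) :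
    Layer d nHead dHead k n :=
  ⟨P, w.1, w.2.1, w.2.2.1, w.2.2.2⟩

/-- The typical behaviour of a layer with input `X`, all relative errors being at most `δ`. The
field `spike` excludes vanishing columns, to which `rmsNorm` does not give the norm `√d`. -/
structure Concentrated (θ : Layer d nHead dHead k n) (hd : d = nHead * dHead) (σ : ℝ → ℝ)
    (δ stσ pσ : ℝ) (X : Matrix (Fin d) (Fin n) ℝ) : Prop where
  heads : ∀ t, colNorm (θ.heads hd X) t ^ 2 ≤ (1 + δ) * d
  att : ResidualUpdate δ 1 X (θ.heads hd X) (θ.att hd X)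
  spike : (∀ t, colNorm (θ.att hd X) t ≠ 0) → stableRank (θ.postAct hd σ X) ≤ stσ ∧
    (k : ℝ) * pσ / d * frobSq (rmsNorm (θ.att hd X)) ≤ frobSq (θ.postAct hd σ X)
  postAct : ∀ t, colNorm (θ.postAct hd σ X) t ^ 2 ≤ (1 + δ) * k
  out : ResidualUpdate δ (d / k) (θ.att hd X) (θ.postAct hd σ X) (θ.out hd σ X)

section Measurable

variable {α : Type*} [MeasurableSpace α] {P : α → Fin nHead → Matrix (Fin n) (Fin n) ℝ}
  {w : α → WeightSpace d nHead dHead k} {X : α → Matrix (Fin d) (Fin n) ℝ} {σ : ℝ → ℝ}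

@[fun_prop]
lemma measurable_heads (hP : Measurable P) (hw : Measurable w) (hX : Measurable X)
    (hd : d = nHead * dHead) : Measurable fun x => (ofWeights (P x) (w x)).heads hd (X x) :=
  measurable_matrix_iff.mpr fun _ t => measurable_matrix_apply
    (measurable_matrix_mul ((measurable_pi_apply _).comp hw.fst)
      (measurable_matrix_mul (measurable_rmsNorm hX) ((measurable_pi_apply _).comp hP))) _ t

@[fun_prop]
lemma measurable_att (hP : Measurable P) (hw : Measurable w) (hX : Measurable X)
    (hd : d = nHead * dHead) : Measurable fun x => (ofWeights (P x) (w x)).att hd (X x) :=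
  measurable_matrix_add hX (measurable_matrix_mul hw.snd.fst (measurable_heads hP hw hX hd))

@[fun_prop]
lemma measurable_postAct (hP : Measurable P) (hw : Measurable w) (hX : Measurable X)
    (hσ : Measurable σ) (hd : d = nHead * dHead) :
    Measurable fun x => (ofWeights (P x) (w x)).postAct hd σ (X x) :=
  measurable_matrix_map (measurable_matrix_mul hw.snd.snd.fst
    (measurable_rmsNorm (measurable_att hP hw hX hd))) hσ

@[fun_prop]
lemma measurable_out (hP : Measurable P) (hw : Measurable w) (hX : Measurable X)
    (hσ : Measurable σ) (hd : d = nHead * dHead) :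
    Measurable fun x => (ofWeights (P x) (w x)).out hd σ (X x) :=
  measurable_matrix_add (measurable_att hP hw hX hd)
    (measurable_matrix_mul hw.snd.snd.snd (measurable_postAct hP hw hX hσ hd))

end Measurable

end Layer

/-! ### The probability that a layer is concentrated -/

section Fubini

variable {α β : Type*} [MeasurableSpace α] [MeasurableSpace β] {μ : Measure α} {ν : Measure β}
  [IsProbabilityMeasure μ] [IsProbabilityMeasure ν] {S : Set (α × β)} {ε : ℝ}

lemma measureReal_le_of_indepFun {Ω : Type*} [MeasurableSpace Ω] {ρ : Measure Ω}
    [IsProbabilityMeasure ρ] {X : Ω → α} {Y : Ω → β} (hX : AEMeasurable X ρ) (hY : HasLaw Y ν ρ)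
    (hindep : IndepFun X Y ρ) (hS : MeasurableSet S)
    (h : ∀ ω, ν.real {y | (X ω, y) ∈ S} ≤ ε) : ρ.real {ω | (X ω, Y ω) ∈ S} ≤ ε := by
  obtain ⟨ω₀⟩ := nonempty_of_isProbabilityMeasure ρ
  have hε : 0 ≤ ε := measureReal_nonneg.trans (h ω₀)
  have hjoint := (indepFun_iff_map_prod_eq_prod_map_map hX hY.aemeasurable).mp hindep
  rw [measureReal_def, ← ENNReal.le_ofReal_iff_toReal_le (measure_ne_top _ _) hε]
  calc ρ {ω | (X ω, Y ω) ∈ S} = (ρ.map fun ω => (X ω, Y ω)) S :=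
        (Measure.map_apply_of_aemeasurable (hX.prodMk hY.aemeasurable) hS).symm
    _ = ∫⁻ ω, ν {y | (X ω, y) ∈ S} ∂ρ := by
        rw [hjoint, hY.map_eq, Measure.prod_apply hS,
          lintegral_map' (measurable_measure_prodMk_left hS).aemeasurable hX]
        rfl
    _ ≤ ∫⁻ _, ENNReal.ofReal ε ∂ρ := lintegral_mono fun ω =>
        (ENNReal.le_ofReal_iff_toReal_le (measure_ne_top _ _) hε).mpr (h ω)
    _ = ENNReal.ofReal ε := by rw [lintegral_const, measure_univ, mul_one]

lemma measureReal_prod_le_of_forall_left (hS : MeasurableSet S)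
    (h : ∀ x, ν.real {y | (x, y) ∈ S} ≤ ε) : (μ.prod ν).real S ≤ ε :=
  measureReal_le_of_indepFun measurable_fst.aemeasurable measurePreserving_snd.hasLaw
    (indepFun_prod measurable_id measurable_id) hS fun p => h p.1

lemma measureReal_prod_le_of_forall_right (hS : MeasurableSet S)
    (h : ∀ y, μ.real {x | (x, y) ∈ S} ≤ ε) : (μ.prod ν).real S ≤ ε := by
  rw [← Measure.prod_swap, map_measureReal_apply measurable_swap hS]
  exact measureReal_prod_le_of_forall_left (measurable_swap hS) h

end Fubini

instance isProbabilityMeasure_weightLaw (d nHead dHead k : ℕ) :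
    IsProbabilityMeasure (weightLaw d nHead dHead k) := by
  unfold weightLaw
  infer_instance

section WeightLaw

variable {d nHead dHead k : ℕ} {S : Set (WeightSpace d nHead dHead k)} {ε : ℝ}

lemma weightLaw_real_le_of_WV (hS : MeasurableSet S)
    (h : ∀ WO W1 W2, (Measure.pi fun _ : Fin nHead => gaussianMatrix dHead d (d : ℝ≥0)⁻¹).real
      {WV | (WV, WO, W1, W2) ∈ S} ≤ ε) :
    (weightLaw d nHead dHead k).real S ≤ ε :=
  measureReal_prod_le_of_forall_right hS fun w => h w.1 w.2.1 w.2.2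

lemma weightLaw_real_le_of_WO (hS : MeasurableSet S)
    (h : ∀ WV W1 W2, (gaussianMatrix d d (d : ℝ≥0)⁻¹).real {WO | (WV, WO, W1, W2) ∈ S} ≤ ε) :
    (weightLaw d nHead dHead k).real S ≤ ε :=
  measureReal_prod_le_of_forall_left hS fun WV =>
    measureReal_prod_le_of_forall_right (measurable_prodMk_left hS) fun w => h WV w.1 w.2

lemma weightLaw_real_le_of_W1 (hS : MeasurableSet S)
    (h : ∀ WV WO W2, (gaussianMatrix k d (d : ℝ≥0)⁻¹).real {W1 | (WV, WO, W1, W2) ∈ S} ≤ ε) :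
    (weightLaw d nHead dHead k).real S ≤ ε :=
  measureReal_prod_le_of_forall_left hS fun WV =>
    measureReal_prod_le_of_forall_left (measurable_prodMk_left hS) fun WO =>
      measureReal_prod_le_of_forall_right (measurable_prodMk_left (measurable_prodMk_left hS))
        fun W2 => h WV WO W2

lemma weightLaw_real_le_of_W2 (hS : MeasurableSet S)
    (h : ∀ WV WO W1, (gaussianMatrix d k (k : ℝ≥0)⁻¹).real {W2 | (WV, WO, W1, W2) ∈ S} ≤ ε) :
    (weightLaw d nHead dHead k).real S ≤ ε :=
  measureReal_prod_le_of_forall_left hS fun WV =>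
    measureReal_prod_le_of_forall_left (measurable_prodMk_left hS) fun WO =>
      measureReal_prod_le_of_forall_left (measurable_prodMk_left (measurable_prodMk_left hS))
        fun W1 => h WV WO W1

end WeightLaw

namespace Layer

variable {d nHead dHead k n : ℕ} {hd : d = nHead * dHead} {σ : ℝ → ℝ} {δ stσ pσ : ℝ}

lemma concentrated_iff {θ : Layer d nHead dHead k n} {X : Matrix (Fin d) (Fin n) ℝ} :
    θ.Concentrated hd σ δ stσ pσ X ↔
      (∀ t, colNorm (θ.heads hd X) t ^ 2 ≤ (1 + δ) * d) ∧
      ResidualUpdate δ 1 X (θ.heads hd X) (θ.att hd X) ∧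
      ((∀ t, colNorm (θ.att hd X) t ≠ 0) → stableRank (θ.postAct hd σ X) ≤ stσ ∧
        (k : ℝ) * pσ / d * frobSq (rmsNorm (θ.att hd X)) ≤ frobSq (θ.postAct hd σ X)) ∧
      (∀ t, colNorm (θ.postAct hd σ X) t ^ 2 ≤ (1 + δ) * k) ∧
      ResidualUpdate δ (d / k) (θ.att hd X) (θ.postAct hd σ X) (θ.out hd σ X) :=
  ⟨fun ⟨h₁, h₂, h₃, h₄, h₅⟩ => ⟨h₁, h₂, h₃, h₄, h₅⟩,
    fun ⟨h₁, h₂, h₃, h₄, h₅⟩ => ⟨h₁, h₂, h₃, h₄, h₅⟩⟩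

section Measurable

variable {α : Type*} [MeasurableSpace α] {P : α → Fin nHead → Matrix (Fin n) (Fin n) ℝ}
  {w : α → WeightSpace d nHead dHead k} {X : α → Matrix (Fin d) (Fin n) ℝ}

lemma measurableSet_spike (hP : Measurable P) (hw : Measurable w) (hX : Measurable X)
    (hσ : Measurable σ) : MeasurableSet {x |
      (∀ t, colNorm ((ofWeights (P x) (w x)).att hd (X x)) t ≠ 0) →
        stableRank ((ofWeights (P x) (w x)).postAct hd σ (X x)) ≤ stσ ∧
        (k : ℝ) * pσ / d * frobSq (rmsNorm ((ofWeights (P x) (w x)).att hd (X x)))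
          ≤ frobSq ((ofWeights (P x) (w x)).postAct hd σ (X x))} := by
  rw [measurableSet_setOfPred]
  refine .imp (.forall fun t => .not ?_) (.and ?_ ?_) <;> rw [← measurableSet_setOfPred]
  · exact measurableSet_eq_fun (by fun_prop) measurable_const
  · exact measurableSet_le (by fun_prop) measurable_const
  · exact measurableSet_le (by fun_prop) (by fun_prop)

lemma measurableSet_concentrated (hP : Measurable P) (hw : Measurable w) (hX : Measurable X)
    (hσ : Measurable σ) :
    MeasurableSet {x | (ofWeights (P x) (w x)).Concentrated hd σ δ stσ pσ (X x)} := by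
  simp only [concentrated_iff]
  refine .inter ?_ (.inter ?_ (.inter ?_ (.inter ?_ ?_)))
  · exact measurableSet_setOfPred.mpr <| .forall fun t =>
      measurableSet_setOfPred.mp (measurableSet_le (by fun_prop) measurable_const)
  · exact measurableSet_residualUpdate hX (by fun_prop) (by fun_prop) δ 1
  · exact measurableSet_spike hP hw hX hσ
  · exact measurableSet_setOfPred.mpr <| .forall fun t =>
      measurableSet_setOfPred.mp (measurableSet_le (by fun_prop) measurable_const)
  · exact measurableSet_residualUpdate (by fun_prop) (by fun_prop) (by fun_prop) δ _

end Measurable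

section Probability

variable {X : Matrix (Fin d) (Fin n) ℝ} {P : Fin nHead → Matrix (Fin n) (Fin n) ℝ}
  {Psucc : ℕ → ℕ → ℕ → ℝ}

lemma weightLaw_not_heads_le (hP : ∀ h, ColumnStochastic (P h)) (hδ₀ : 0 ≤ δ) (hδ₂ : δ ≤ 2)
    (hd₁ : 1 ≤ d) :
    (weightLaw d nHead dHead k).real
        {w | ¬ ∀ t, colNorm ((ofWeights P w).heads hd X) t ^ 2 ≤ (1 + δ) * d}
      ≤ n * Real.exp (-(δ ^ 2 / 16 * d)) := by
  have hd₀ : (d : ℝ≥0) ≠ 0 := by positivity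
  refine (measureReal_not_forall_le fun t => weightLaw_real_le_of_WV
    (ε := Real.exp (-(δ ^ 2 / 16 * d))) ?_ fun WO W1 W2 => ?_).trans_eq (by rw [Fintype.card_fin])
  · simp only [not_le]
    exact measurableSet_lt measurable_const (by fun_prop)
  have hcol : ∀ h, ‖WithLp.toLp 2 fun j => (rmsNorm X * P h) j t‖₊ ^ 2 ≤ (d : ℝ≥0) := fun h => by
    rw [← NNReal.coe_le_coe]
    push_cast
    rw [EuclideanSpace.real_norm_sq_eq]
    simpa only [colNorm_sq] using
      colNorm_mul_columnStochastic_sq_le (colNorm_rmsNorm_sq_le X) (hP h) t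
  have hexp := measureReal_sum_sum_mulVec_sq_le_exp dHead nHead (v := (d : ℝ≥0)⁻¹)
    (by positivity) hδ₀ hδ₂ (by positivity) hcol
  rw [← hd, ← NNReal.coe_mul, inv_mul_cancel₀ hd₀, NNReal.coe_one, mul_one] at hexp
  refine (measureReal_mono fun WV hWV => ?_).trans hexp
  have hlt := (not_le.mp hWV).le
  rwa [heads, colNorm_concatHeads_sq] at hlt

lemma weightLaw_not_att_le (hδ₀ : 0 ≤ δ) (hδ₁ : δ ≤ 1 / 2) (hd₁ : 1 ≤ d) :
    (weightLaw d nHead dHead k).real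
        {w | ¬ ResidualUpdate δ 1 X ((ofWeights P w).heads hd X) ((ofWeights P w).att hd X)}
      ≤ (n + 2) * (4 * Real.exp (-(δ ^ 2 / 16 * d))) := by
  refine weightLaw_real_le_of_WO ?_ fun WV _ _ => ?_
  · exact (measurableSet_residualUpdate measurable_const (by fun_prop) (by fun_prop) δ 1).compl
  have hupdate := measureReal_not_residualUpdate_le (a := d) (v := (d : ℝ≥0)⁻¹) (by positivity)
    hδ₀ hδ₁ X (concatHeads hd fun h => WV h * (rmsNorm X * P h))
  rwa [NNReal.coe_inv, NNReal.coe_natCast, mul_inv_cancel₀ (by positivity)] at hupdate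

lemma weightLaw_not_spike_le (hspike : MeanSpike σ stσ pσ Psucc) (hd₁ : 1 ≤ d) (hk₁ : 1 ≤ k)
    (hn₁ : 1 ≤ n) :
    (weightLaw d nHead dHead k).real
        {w | ¬ ((∀ t, colNorm ((ofWeights P w).att hd X) t ≠ 0) →
          stableRank ((ofWeights P w).postAct hd σ X) ≤ stσ ∧
          (k : ℝ) * pσ / d * frobSq (rmsNorm ((ofWeights P w).att hd X))
            ≤ frobSq ((ofWeights P w).postAct hd σ X))}
      ≤ 1 - Psucc d k n := by
  have hσ : Measurable σ := hspike.lipschitz.continuous.measurable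
  refine weightLaw_real_le_of_W1 ?_ fun WV WO W2 => ?_
  · exact (measurableSet_spike measurable_const measurable_id measurable_const hσ).compl
  set Y := X + WO * concatHeads hd fun h => WV h * (rmsNorm X * P h)
  by_cases hY : ∀ t, colNorm Y t ≠ 0
  · have hbound := hspike.bound d k n hd₁ hk₁ hn₁ (rmsNorm Y)
      fun s t => by rw [colNorm_rmsNorm (hY s), colNorm_rmsNorm (hY t)]
    have hmeas : MeasurableSet {W : Matrix (Fin k) (Fin d) ℝ |
        stableRank ((W * rmsNorm Y).map σ) ≤ stσ ∧
        (k : ℝ) * pσ / d * frobSq (rmsNorm Y) ≤ frobSq ((W * rmsNorm Y).map σ)} := by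
      rw [measurableSet_setOfPred]
      refine .and ?_ ?_ <;> rw [← measurableSet_setOfPred]
      · exact measurableSet_le (by fun_prop) measurable_const
      · exact measurableSet_le measurable_const (by fun_prop)
    refine (measureReal_mono fun W hW => ?_).trans
      ((probReal_compl_eq_one_sub hmeas).trans_le (sub_le_sub_left hbound 1))
    exact fun hsuccess => hW fun _ => hsuccess
  · have hP₁ : Psucc d k n ≤ 1 :=
      (hspike.bound d k n hd₁ hk₁ hn₁ 0 fun _ _ => rfl).trans measureReal_le_one
    refine (measureReal_mono fun W hW => ?_).trans
      (measureReal_empty.trans_le (sub_nonneg.mpr hP₁))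
    exact hW fun hne => absurd hne hY

lemma weightLaw_not_postAct_le (hσ : Measurable σ) (hσ_abs : ∀ x, |σ x| ≤ |x|) (hδ₀ : 0 ≤ δ)
    (hδ₂ : δ ≤ 2) (hd₁ : 1 ≤ d) :
    (weightLaw d nHead dHead k).real
        {w | ¬ ∀ t, colNorm ((ofWeights P w).postAct hd σ X) t ^ 2 ≤ (1 + δ) * k}
      ≤ n * Real.exp (-(δ ^ 2 / 16 * k)) := by
  have hd₀ : (d : ℝ≥0) ≠ 0 := by positivity
  refine (measureReal_not_forall_le fun t => weightLaw_real_le_of_W1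
    (ε := Real.exp (-(δ ^ 2 / 16 * k))) ?_ fun WV WO W2 => ?_).trans_eq (by rw [Fintype.card_fin])
  · simp only [not_le]
    exact measurableSet_lt measurable_const (by fun_prop)
  set A := rmsNorm (X + WO * concatHeads hd fun h => WV h * (rmsNorm X * P h))
  have hcol : ‖WithLp.toLp 2 fun j => A j t‖₊ ^ 2 ≤ (d : ℝ≥0) := by
    rw [← NNReal.coe_le_coe]
    push_cast
    rw [EuclideanSpace.real_norm_sq_eq]
    simpa only [colNorm_sq] using colNorm_rmsNorm_sq_le _ t
  have hexp := measureReal_sum_mulVec_sq_le_exp k (v := (d : ℝ≥0)⁻¹) (by positivity) hδ₀ hδ₂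
    (by positivity) hcol
  rw [← NNReal.coe_mul, inv_mul_cancel₀ hd₀, NNReal.coe_one, mul_one] at hexp
  refine (measureReal_mono fun W hW => ?_).trans hexp
  have hlt := (not_le.mp hW).le
  rw [colNorm_sq] at hlt
  exact hlt.trans (Finset.sum_le_sum fun i _ => sq_le_sq.mpr (hσ_abs _))

lemma weightLaw_not_out_le (hσ : Measurable σ) (hδ₀ : 0 ≤ δ) (hδ₁ : δ ≤ 1 / 2) (hk₁ : 1 ≤ k) :
    (weightLaw d nHead dHead k).real
        {w | ¬ ResidualUpdate δ (d / k) ((ofWeights P w).att hd X) ((ofWeights P w).postAct hd σ X)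
          ((ofWeights P w).out hd σ X)}
      ≤ (n + 2) * (4 * Real.exp (-(δ ^ 2 / 16 * d))) := by
  refine weightLaw_real_le_of_W2 ?_ fun WV WO W1 => ?_
  · exact (measurableSet_residualUpdate (by fun_prop) (by fun_prop) (by fun_prop) δ _).compl
  set Y := X + WO * concatHeads hd fun h => WV h * (rmsNorm X * P h)
  have hupdate := measureReal_not_residualUpdate_le (a := d) (v := (k : ℝ≥0)⁻¹) (by positivity)
    hδ₀ hδ₁ Y ((W1 * rmsNorm Y).map σ)
  rwa [NNReal.coe_inv, NNReal.coe_natCast, ← div_eq_mul_inv] at hupdate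

lemma weightLaw_not_concentrated_le (hspike : MeanSpike σ stσ pσ Psucc)
    (hP : ∀ h, ColumnStochastic (P h)) (hδ₀ : 0 ≤ δ) (hδ₁ : δ ≤ 1 / 2) (hd₁ : 1 ≤ d)
    (hk₁ : 1 ≤ k) (hn₁ : 1 ≤ n) :
    (weightLaw d nHead dHead k).real {w | ¬ (ofWeights P w).Concentrated hd σ δ stσ pσ X}
      ≤ 25 * n * Real.exp (-(δ ^ 2 / 16 * d)) + n * Real.exp (-(δ ^ 2 / 16 * k))
        + (1 - Psucc d k n) := by
  have hσ : Measurable σ := hspike.lipschitz.continuous.measurable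
  simp only [concentrated_iff]
  refine (measureReal_not_and_le (weightLaw_not_heads_le hP hδ₀ (by linarith) hd₁) <|
    measureReal_not_and_le (weightLaw_not_att_le hδ₀ hδ₁ hd₁) <|
    measureReal_not_and_le (weightLaw_not_spike_le hspike hd₁ hk₁ hn₁) <|
    measureReal_not_and_le (weightLaw_not_postAct_le hσ hspike.abs_le hδ₀ (by linarith) hd₁)
      (weightLaw_not_out_le hσ hδ₀ hδ₁ hk₁)).trans ?_
  have hn : (1 : ℝ) ≤ n := by exact_mod_cast hn₁
  linarith [mul_le_mul_of_nonneg_right hn (Real.exp_nonneg (-(δ ^ 2 / 16 * d)))]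

end Probability

end Layer

/-! ### Growth of the residual stream -/

lemma NearPythagorean.sq_le {δ p q r u s D : ℝ} (h : NearPythagorean δ p q r) (hδ : 0 ≤ δ)
    (hs : 0 ≤ s) (hus : u ≤ s ^ 2) (hD : 0 ≤ D) (hp : p ^ 2 ≤ u * D)
    (hq : q ^ 2 ≤ (1 + δ) * D) : r ^ 2 ≤ (u + 2 * δ * (1 + δ) * s + (1 + δ) ^ 2) * D := by
  have hpq : p * q ≤ (1 + δ) * s * D := by
    refine le_of_abs_le (abs_le_of_sq_le_sq ?_ (by positivity))
    calc (p * q) ^ 2 = p ^ 2 * q ^ 2 := mul_pow _ _ _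
      _ ≤ s ^ 2 * D * ((1 + δ) * D) := by
          refine mul_le_mul (hp.trans ?_) hq (sq_nonneg q) (by positivity)
          gcongr
      _ ≤ s ^ 2 * D * ((1 + δ) ^ 2 * D) := by
          gcongr
          nlinarith
      _ = ((1 + δ) * s * D) ^ 2 := by ring
  calc r ^ 2 ≤ p ^ 2 + 2 * δ * (p * q) + (1 + δ) * q ^ 2 := h.2
    _ ≤ u * D + 2 * δ * ((1 + δ) * s * D) + (1 + δ) * ((1 + δ) * D) := by gcongr
    _ = (u + 2 * δ * (1 + δ) * s + (1 + δ) ^ 2) * D := by ring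

namespace Layer.Concentrated

variable {d nHead dHead k n : ℕ} {hd : d = nHead * dHead} {σ : ℝ → ℝ} {δ stσ pσ : ℝ}
  {θ : Layer d nHead dHead k n} {X : Matrix (Fin d) (Fin n) ℝ} {t : Fin n}

lemma colNorm_att_ne_zero (h : θ.Concentrated hd σ δ stσ pσ X) (hδ : δ < 1 / 2)
    (hX : colNorm X t ≠ 0) : colNorm (θ.att hd X) t ≠ 0 :=
  h.att.colNorm_ne_zero hδ hX

lemma colNorm_out_ne_zero (h : θ.Concentrated hd σ δ stσ pσ X) (hδ : δ < 1 / 2)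
    (hX : colNorm X t ≠ 0) : colNorm (θ.out hd σ X) t ≠ 0 :=
  h.out.colNorm_ne_zero hδ (h.colNorm_att_ne_zero hδ hX)

lemma colNorm_att_sq_le (h : θ.Concentrated hd σ δ stσ pσ X) (hδ : 0 ≤ δ) {s : ℝ} (hs : 0 ≤ s)
    (hX : colNorm X t ^ 2 ≤ s ^ 2 * d) :
    colNorm (θ.att hd X) t ^ 2 ≤ (s ^ 2 + 2 * δ * (1 + δ) * s + (1 + δ) ^ 2) * d := by
  refine (h.att.colNorm t).sq_le hδ hs le_rfl (Nat.cast_nonneg d) hX ?_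
  rw [Real.sqrt_one, one_mul]
  exact h.heads t

lemma colNorm_out_sq_le (h : θ.Concentrated hd σ δ stσ pσ X) (hδ : 0 ≤ δ) (hk : 0 < k)
    {s u : ℝ} (hs : 0 ≤ s) (hus : u ≤ s ^ 2) (hX : colNorm (θ.att hd X) t ^ 2 ≤ u * d) :
    colNorm (θ.out hd σ X) t ^ 2 ≤ (u + 2 * δ * (1 + δ) * s + (1 + δ) ^ 2) * d := by
  have hk₀ : (k : ℝ) ≠ 0 := by positivity
  refine (h.out.colNorm t).sq_le hδ hs hus (Nat.cast_nonneg d) hX ?_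
  calc (√(d / k) * colNorm (θ.postAct hd σ X) t) ^ 2
      = d / k * colNorm (θ.postAct hd σ X) t ^ 2 := by
        rw [mul_pow, Real.sq_sqrt (by positivity)]
    _ ≤ d / k * ((1 + δ) * k) := by gcongr; exact h.postAct t
    _ = (1 + δ) * d := by field_simp

lemma mul_le_opNorm_out_sq (h : θ.Concentrated hd σ δ stσ pσ X) (hδ : δ < 1 / 2) (hd₀ : 0 < d)
    (hk₀ : 0 < k) (hX : ∀ t, colNorm X t ≠ 0) :
    (1 - 2 * δ) * (n * d * pσ) ≤ stσ * opNorm (θ.out hd σ X) ^ 2 := by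
  obtain ⟨hst, hfrob⟩ := h.spike fun t => h.colNorm_att_ne_zero hδ (hX t)
  rw [frobSq_rmsNorm fun t => h.colNorm_att_ne_zero hδ (hX t)] at hfrob
  set B := θ.postAct hd σ X
  have hst₀ : 0 ≤ stσ := (stableRank_nonneg B).trans hst
  calc (1 - 2 * δ) * (n * d * pσ)
      = (1 - 2 * δ) * (d / k * (k * pσ / d * (n * d))) := by field_simp
    _ ≤ (1 - 2 * δ) * (d / k * (stσ * opNorm B ^ 2)) := by
        refine mul_le_mul_of_nonneg_left (mul_le_mul_of_nonneg_left ?_ (by positivity))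
          (by linarith)
        exact hfrob.trans (frobSq_le_mul_opNorm_sq hst)
    _ = stσ * ((1 - 2 * δ) * (d / k * opNorm B ^ 2)) := by ring
    _ ≤ stσ * opNorm (θ.out hd σ X) ^ 2 := by
        gcongr
        exact h.out.opNorm_right

end Layer.Concentrated

section Forward

variable {L d nHead dHead k n : ℕ} {hd : d = nHead * dHead} {σ : ℝ → ℝ} {stσ pσ : ℝ}
  {θ : Fin L → Layer d nHead dHead k n} {X₀ : Matrix (Fin d) (Fin n) ℝ}

lemma hidden_succ (j : Fin L) :
    hidden hd σ θ X₀ j.succ = (θ j).out hd σ (hidden hd σ θ X₀ j.castSucc) :=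
  Fin.induction_succ _ _ _

variable (hd σ stσ pσ θ X₀) in
/-- The typical behaviour of a forward pass started at `X₀`: the columns of `X₀` have norm about
`√d`, and every layer is concentrated at its own input. The relative error `1 / 500` is small enough
for the numerical constants of the stable rank bounds. -/
structure ConcentratedForward : Prop where
  input : ∀ t, 0.996 * d ≤ colNorm X₀ t ^ 2 ∧ colNorm X₀ t ^ 2 ≤ 1.002 * d
  layer : ∀ ℓ, (θ ℓ).Concentrated hd σ (1 / 500) stσ pσ (hidden hd σ θ X₀ ℓ.castSucc)

namespace ConcentratedForward

lemma colNorm_hidden_ne_zero (h : ConcentratedForward hd σ stσ pσ θ X₀) (hd₀ : 0 < d)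
    (m : Fin (L + 1)) : ∀ t, colNorm (hidden hd σ θ X₀ m) t ≠ 0 := by
  induction m using Fin.induction with
  | zero =>
    refine fun t => ne_of_apply_ne (· ^ 2) (ne_of_gt ?_)
    rw [zero_pow two_ne_zero]
    exact lt_of_lt_of_le (by positivity) (h.input t).1
  | succ j ih =>
    rw [hidden_succ]
    exact fun t => (h.layer j).colNorm_out_ne_zero (by norm_num) (ih t)

lemma colNorm_hidden_sq_le (h : ConcentratedForward hd σ stσ pσ θ X₀) (hk : 0 < k)
    (m : Fin (L + 1)) :
    ∀ t, colNorm (hidden hd σ θ X₀ m) t ^ 2 ≤ (1.05 * (m + 1 : ℝ)) ^ 2 * d := by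
  induction m using Fin.induction with
  | zero =>
    refine fun t => (h.input t).2.trans ?_
    gcongr
    norm_num
  | succ j ih =>
    intro t
    rw [hidden_succ]
    set s : ℝ := 1.05 * (j + 1) with hs
    have : 1.05 ≤ s := by linarith [(Nat.cast_nonneg (j : ℕ) : (0 : ℝ) ≤ (j : ℕ))]
    have hatt := (h.layer j).colNorm_att_sq_le (by norm_num) (by linarith) (ih t)
    refine ((h.layer j).colNorm_out_sq_le (by norm_num) hk (s := s + 1) (by linarith)
      (by norm_num; nlinarith) hatt).trans ?_
    have hsucc : 1.05 * (((j.succ : Fin (L + 1)) : ℝ) + 1) = s + 1.05 := by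
      rw [Fin.val_succ, hs]
      push_cast
      ring
    rw [hsucc]
    gcongr
    norm_num
    nlinarith

lemma colNorm_att_sq_le (h : ConcentratedForward hd σ stσ pσ θ X₀) (hk : 0 < k) (ℓ : Fin L)
    (t : Fin n) :
    colNorm ((θ ℓ).att hd (hidden hd σ θ X₀ ℓ.castSucc)) t ^ 2 ≤ 2.2 * (ℓ + 1 : ℝ) ^ 2 * d := by
  have : (0 : ℝ) ≤ (ℓ : ℕ) := Nat.cast_nonneg _
  refine ((h.layer ℓ).colNorm_att_sq_le (by norm_num) (by positivity)
    (h.colNorm_hidden_sq_le hk ℓ.castSucc t)).trans ?_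
  gcongr
  rw [Fin.val_castSucc]
  norm_num
  nlinarith

lemma mul_le_opNorm_hidden_sq (h : ConcentratedForward hd σ stσ pσ θ X₀) (hd₀ : 0 < d)
    (hk₀ : 0 < k) {m : Fin (L + 1)} (hm : m ≠ 0) :
    0.996 * (n * d * pσ) ≤ stσ * opNorm (hidden hd σ θ X₀ m) ^ 2 := by
  obtain ⟨j, rfl⟩ := Fin.exists_succ_eq.mpr hm
  rw [hidden_succ]
  convert (h.layer j).mul_le_opNorm_out_sq (by norm_num) hd₀ hk₀ (h.colNorm_hidden_ne_zero hd₀ _)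
    using 2
  norm_num

lemma stableRank_rmsNorm_hidden_le (h : ConcentratedForward hd σ stσ pσ θ X₀) (hd₀ : 0 < d)
    (hk₀ : 0 < k) (hn₀ : 0 < n) (hp : 0 < pσ) {m : Fin (L + 1)} (hm : m ≠ 0) :
    stableRank (rmsNorm (hidden hd σ θ X₀ m)) ≤ 1.11 * (stσ / pσ) * (m + 1 : ℝ) ^ 2 := by
  have hop := h.mul_le_opNorm_hidden_sq hd₀ hk₀ hm
  have hst : 0 < stσ := pos_of_mul_pos_left (lt_of_lt_of_le (by positivity) hop) (sq_nonneg _)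
  refine stableRank_rmsNorm_le (s := 0.996 * (n * d * pσ) / stσ) (by positivity) (by positivity)
    (h.colNorm_hidden_sq_le hk₀ m) (by rwa [div_le_iff₀' hst]) (by positivity) ?_
  calc n * d * (1.05 * (m + 1 : ℝ)) ^ 2 = n * d * (1.05 ^ 2 * (m + 1 : ℝ) ^ 2) := by ring
    _ ≤ n * d * (1.11 * 0.996 * (m + 1 : ℝ) ^ 2) := by gcongr; norm_num
    _ = 1.11 * (stσ / pσ) * (m + 1 : ℝ) ^ 2 * (0.996 * (n * d * pσ) / stσ) := by field_simp

lemma stableRank_rmsNorm_att_le (h : ConcentratedForward hd σ stσ pσ θ X₀) (hd₀ : 0 < d)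
    (hk₀ : 0 < k) (hn₀ : 0 < n) (hp : 0 < pσ) {ℓ : Fin L} (hℓ : ℓ.castSucc ≠ 0) :
    stableRank (rmsNorm ((θ ℓ).att hd (hidden hd σ θ X₀ ℓ.castSucc)))
      ≤ 2.22 * (stσ / pσ) * (ℓ + 1 : ℝ) ^ 2 := by
  have hop := h.mul_le_opNorm_hidden_sq hd₀ hk₀ hℓ
  have hst : 0 < stσ := pos_of_mul_pos_left (lt_of_lt_of_le (by positivity) hop) (sq_nonneg _)
  have hatt : 0.996 * (0.996 * (n * d * pσ) / stσ)
      ≤ opNorm ((θ ℓ).att hd (hidden hd σ θ X₀ ℓ.castSucc)) ^ 2 := by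
    rw [← div_le_iff₀' hst] at hop
    linarith [(h.layer ℓ).att.opNorm_left]
  refine stableRank_rmsNorm_le (by positivity) (by positivity) (h.colNorm_att_sq_le hk₀ ℓ) hatt
    (by positivity) ?_
  calc n * d * (2.2 * (ℓ + 1 : ℝ) ^ 2)
      ≤ n * d * (2.22 * 0.996 * 0.996 * (ℓ + 1 : ℝ) ^ 2) := by gcongr; norm_num
    _ = 2.22 * (stσ / pσ) * (ℓ + 1 : ℝ) ^ 2 * (0.996 * (0.996 * (n * d * pσ) / stσ)) := by
        field_simp

end ConcentratedForward

end Forward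

/-! ### The token embedding -/

section Embedding

variable {d n V : ℕ} {tok : Fin n → Fin V} {E : Matrix (Fin d) (Fin V) ℝ}

lemma measureReal_not_colNorm_sq_le {a b : ℕ} {v : ℝ≥0} {δ : ℝ} (hv : 0 < v) (hδ₀ : 0 ≤ δ)
    (hδ₂ : δ ≤ 2) (j : Fin b) :
    (gaussianMatrix a b v).real {G | ¬ ((1 - 2 * δ) * (a * v) ≤ colNorm G j ^ 2 ∧
      colNorm G j ^ 2 ≤ (1 + δ) * (a * v))} ≤ 4 * Real.exp (-(δ ^ 2 / 16 * a)) := by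
  have h := measureReal_not_nearPythagorean_mulVec_le (a := a) hv hδ₀ hδ₂ 0
    (EuclideanSpace.single j 1)
  simpa [NearPythagorean, colNorm_eq_norm_mulVec_single, mul_pow] using h

lemma pMax_pos (hn : 0 < n) (tok : Fin n → Fin V) : 0 < pMax tok := by
  refine lt_of_lt_of_le ?_ (le_ciSup (Set.finite_range (tokenFreq tok)).bddAbove (tok ⟨0, hn⟩))
  have hmem : (⟨0, hn⟩ : Fin n) ∈ Finset.univ.filter fun t => tok t = tok ⟨0, hn⟩ := by simp
  exact div_pos (by exact_mod_cast Finset.card_pos.mpr ⟨_, hmem⟩) (by exact_mod_cast hn)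

lemma exists_card_filter_eq_mul_pMax (hn : 0 < n) (tok : Fin n → Fin V) :
    ∃ t₀, ((Finset.univ.filter fun t => tok t = tok t₀).card : ℝ) = n * pMax tok := by
  have : Nonempty (Fin V) := ⟨tok ⟨0, hn⟩⟩
  obtain ⟨j, hj⟩ := exists_eq_ciSup_of_finite (f := tokenFreq tok)
  have hcard : ((Finset.univ.filter fun t => tok t = j).card : ℝ) = n * pMax tok := by
    rw [pMax, ← hj, tokenFreq]
    field_simp
  have hpos : (0 : ℝ) < (Finset.univ.filter fun t => tok t = j).card :=
    hcard ▸ mul_pos (by exact_mod_cast hn) (pMax_pos hn tok)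
  obtain ⟨t₀, ht₀⟩ := Finset.card_pos.mp (by exact_mod_cast hpos)
  exact ⟨t₀, by rwa [(Finset.mem_filter.mp ht₀).2]⟩

lemma mul_pMax_mul_le_opNorm_embed_sq (hn : 0 < n) {c : ℝ}
    (hE : ∀ t, c ≤ colNorm (embed tok E) t ^ 2) :
    n * pMax tok * c ≤ opNorm (embed tok E) ^ 2 := by
  obtain ⟨t₀, ht₀⟩ := exists_card_filter_eq_mul_pMax hn tok
  have hop := card_mul_sq_le_opNorm_sq (M := embed tok E) (x := fun i => E i (tok t₀))
    (T := Finset.univ.filter fun t => tok t = tok t₀) fun t ht i =>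
      congrArg (E i) (Finset.mem_filter.mp ht).2
  have hc := hE t₀
  rw [colNorm_sq] at hc
  rw [ht₀] at hop
  exact (mul_le_mul_of_nonneg_left hc (mul_nonneg (Nat.cast_nonneg n) (pMax_pos hn tok).le)).trans
    hop

namespace ConcentratedForward

variable {L nHead dHead k : ℕ} {hd : d = nHead * dHead} {σ : ℝ → ℝ} {stσ pσ : ℝ}
  {θ : Fin L → Layer d nHead dHead k n}

lemma stableRank_embed_le (h : ConcentratedForward hd σ stσ pσ θ (embed tok E)) (hd₀ : 0 < d)
    (hn₀ : 0 < n) : stableRank (embed tok E) ≤ 1.01 / pMax tok := by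
  have hp := pMax_pos hn₀ tok
  refine stableRank_le_of_frobSq_le (F := n * (1.002 * d)) ?_ (by positivity)
    (mul_pMax_mul_le_opNorm_embed_sq hn₀ fun t => (h.input t).1) (by positivity) ?_
  · rw [frobSq_eq_sum_colNorm_sq]
    exact (Finset.sum_le_sum fun t _ => (h.input t).2).trans_eq (by simp)
  · calc (n : ℝ) * (1.002 * d) ≤ n * (1.01 * 0.996 * d) := by gcongr; norm_num
      _ = 1.01 / pMax tok * (n * pMax tok * (0.996 * d)) := by field_simp

lemma stableRank_rmsNorm_embed_le (h : ConcentratedForward hd σ stσ pσ θ (embed tok E))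
    (hd₀ : 0 < d) (hn₀ : 0 < n) : stableRank (rmsNorm (embed tok E)) ≤ 1.03 / pMax tok := by
  have hp := pMax_pos hn₀ tok
  refine stableRank_rmsNorm_le (by norm_num) (by positivity) (fun t => (h.input t).2)
    (mul_pMax_mul_le_opNorm_embed_sq hn₀ fun t => (h.input t).1) (by positivity) ?_
  calc (n : ℝ) * d * 1.002 ≤ n * d * (1.03 * 0.996) := by gcongr; norm_num
    _ = 1.03 / pMax tok * (n * pMax tok * (0.996 * d)) := by field_simp

lemma stableRank_rmsNorm_att_embed_le (h : ConcentratedForward hd σ stσ pσ θ (embed tok E))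
    (hd₀ : 0 < d) (hk₀ : 0 < k) (hn₀ : 0 < n) {ℓ : Fin L} (hℓ : ℓ.castSucc = 0) :
    stableRank (rmsNorm ((θ ℓ).att hd (hidden hd σ θ (embed tok E) ℓ.castSucc)))
      ≤ 6.03 / pMax tok := by
  have hp := pMax_pos hn₀ tok
  have hℓ₀ : ((ℓ : ℕ) : ℝ) = 0 := by simpa [Fin.ext_iff] using hℓ
  have hcol := h.colNorm_att_sq_le hk₀ ℓ
  have hatt := (h.layer ℓ).att.opNorm_left
  simp only [hℓ₀, zero_add, one_pow, mul_one] at hcol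
  have hop : n * pMax tok * (0.996 * d) ≤ opNorm (hidden hd σ θ (embed tok E) ℓ.castSucc) ^ 2 :=
    hℓ ▸ mul_pMax_mul_le_opNorm_embed_sq hn₀ fun t => (h.input t).1
  refine stableRank_rmsNorm_le (s := 0.996 * (n * pMax tok * (0.996 * d))) (by norm_num)
    (by positivity) hcol (by linarith) (by positivity) ?_
  calc (n : ℝ) * d * 2.2 ≤ n * d * (6.03 * 0.996 * 0.996) := by gcongr; norm_num
    _ = 6.03 / pMax tok * (0.996 * (n * pMax tok * (0.996 * d))) := by field_simp

end ConcentratedForward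

end Embedding

/-! ### The random network -/

section Random

variable {L d nHead dHead k n V : ℕ} {hd : d = nHead * dHead} {σ : ℝ → ℝ}

lemma measurable_hidden {α : Type*} [MeasurableSpace α] (hσ : Measurable σ)
    {P : Fin L → α → Fin nHead → Matrix (Fin n) (Fin n) ℝ}
    {w : Fin L → α → WeightSpace d nHead dHead k} {X₀ : α → Matrix (Fin d) (Fin n) ℝ}
    (hP : ∀ j, Measurable (P j)) (hw : ∀ j, Measurable (w j)) (hX₀ : Measurable X₀)
    (m : Fin (L + 1)) :
    Measurable fun x => hidden hd σ (fun j => Layer.ofWeights (P j x) (w j x)) (X₀ x) m := by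
  induction m using Fin.induction with
  | zero => exact hX₀
  | succ j ih =>
    simp_rw [hidden_succ]
    exact Layer.measurable_out (hP j) (hw j) ih hσ hd

lemma hidden_congr {θ θ' : Fin L → Layer d nHead dHead k n} {X₀ : Matrix (Fin d) (Fin n) ℝ}
    {m : Fin (L + 1)} (h : ∀ j : Fin L, j.castSucc < m → θ j = θ' j) :
    hidden hd σ θ X₀ m = hidden hd σ θ' X₀ m := by
  induction m using Fin.induction with
  | zero => simp only [hidden, Fin.induction_zero]
  | succ j ih =>
    rw [hidden_succ, hidden_succ, h j j.castSucc_lt_succ,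
      ih fun i hi => h i (hi.trans j.castSucc_lt_succ)]

lemma measurable_embed (tok : Fin n → Fin V) :
    Measurable (embed tok : Matrix (Fin d) (Fin V) ℝ → Matrix (Fin d) (Fin n) ℝ) :=
  measurable_matrix_iff.mpr fun i t => measurable_matrix_apply measurable_id i (tok t)

/-- What the layers before layer `ℓ` and the mixing matrices of layer `ℓ` depend on: the embedding,
the earlier weights, and the mixing matrices up to layer `ℓ`. -/
abbrev PastSpace (d nHead dHead k n V : ℕ) (ℓ : Fin L) : Type :=
  Matrix (Fin d) (Fin V) ℝ × ({j : Fin L // j < ℓ} → WeightSpace d nHead dHead k) ×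
    ({j : Fin L // j ≤ ℓ} → Fin nHead → Matrix (Fin n) (Fin n) ℝ)

lemma exists_measurable_hidden_eq_of_past (hd : d = nHead * dHead) (hσ : Measurable σ)
    (tok : Fin n → Fin V) (ℓ : Fin L) :
    ∃ F : PastSpace d nHead dHead k n V ℓ → Matrix (Fin d) (Fin n) ℝ, Measurable F ∧
      ∀ (E : Matrix (Fin d) (Fin V) ℝ) (θ : Fin L → Layer d nHead dHead k n),
        F (E, (fun j => (θ j).weights), fun j => (θ j).P)
          = hidden hd σ θ (embed tok E) ℓ.castSucc := by
  refine ⟨fun p => hidden hd σ (fun j => Layer.ofWeights (if h : j ≤ ℓ then p.2.2 ⟨j, h⟩ else 0)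
    (if h : j < ℓ then p.2.1 ⟨j, h⟩ else 0)) (embed tok p.1) ℓ.castSucc, ?_, fun E θ => ?_⟩
  · refine measurable_hidden hσ (fun j => ?_) (fun j => ?_)
      ((measurable_embed tok).comp measurable_fst) _
    · split_ifs <;> fun_prop
    · split_ifs <;> fun_prop
  · refine hidden_congr fun j hj => ?_
    have hj : j < ℓ := hj
    simp only [dif_pos hj, dif_pos hj.le]
    rfl

namespace GaussianInit

variable {Ω : Type*} [MeasurableSpace Ω] {μ : Measure Ω}
  {E : Ω → Matrix (Fin d) (Fin V) ℝ} {θ : Fin L → Ω → Layer d nHead dHead k n}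

lemma aemeasurable_past (hG : GaussianInit μ E θ) (ℓ : Fin L) :
    AEMeasurable (fun ω => ((E ω, (fun j => (θ j ω).weights), fun j => (θ j ω).P) :
      PastSpace d nHead dHead k n V ℓ)) μ :=
  hG.law_embedding.aemeasurable.prodMk
    ((aemeasurable_pi_iff.mpr fun j : {j // j < ℓ} => (hG.law_weights j).aemeasurable).prodMk
      (measurable_pi_iff.mpr fun j : {j // j ≤ ℓ} =>
        measurable_pi_iff.mpr (hG.measurable_P j)).aemeasurable)

lemma measureReal_not_concentrated_le [IsProbabilityMeasure μ] (hG : GaussianInit μ E θ)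
    {stσ pσ δ : ℝ} {Psucc : ℕ → ℕ → ℕ → ℝ} (hspike : MeanSpike σ stσ pσ Psucc) (hδ₀ : 0 ≤ δ)
    (hδ₁ : δ ≤ 1 / 2) (hd₁ : 1 ≤ d) (hk₁ : 1 ≤ k) (hn₁ : 1 ≤ n) (tok : Fin n → Fin V)
    (ℓ : Fin L) :
    μ.real {ω | ¬ (θ ℓ ω).Concentrated hd σ δ stσ pσ
        (hidden hd σ (θ · ω) (embed tok (E ω)) ℓ.castSucc)}
      ≤ 25 * n * Real.exp (-(δ ^ 2 / 16 * d)) + n * Real.exp (-(δ ^ 2 / 16 * k))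
        + (1 - Psucc d k n) := by
  have hσ : Measurable σ := hspike.lipschitz.continuous.measurable
  obtain ⟨F, hF, hF_eq⟩ := exists_measurable_hidden_eq_of_past (k := k) hd hσ tok ℓ
  have hS : MeasurableSet {q : PastSpace d nHead dHead k n V ℓ × WeightSpace d nHead dHead k |
      ¬ (Layer.ofWeights (q.1.2.2 ⟨ℓ, le_rfl⟩) q.2).Concentrated hd σ δ stσ pσ (F q.1)} :=
    (Layer.measurableSet_concentrated (by fun_prop) measurable_snd (hF.comp measurable_fst)
      hσ).compl
  have h := measureReal_le_of_indepFun (hG.aemeasurable_past ℓ) (hG.law_weights ℓ) (hG.indep ℓ) hS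
    fun ω => by
      simpa only [Set.mem_ofPred_eq] using Layer.weightLaw_not_concentrated_le hspike
        (fun h => hG.stochastic_P ℓ h ω) hδ₀ hδ₁ hd₁ hk₁ hn₁
  simp only [Set.mem_ofPred_eq, fun ω => hF_eq (E ω) (θ · ω)] at h
  exact h

lemma measureReal_not_colNorm_embed_sq_le (hG : GaussianInit μ E θ) {δ : ℝ} (hδ₀ : 0 ≤ δ)
    (hδ₂ : δ ≤ 2) (tok : Fin n → Fin V) :
    μ.real {ω | ¬ ∀ t, (1 - 2 * δ) * d ≤ colNorm (embed tok (E ω)) t ^ 2 ∧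
        colNorm (embed tok (E ω)) t ^ 2 ≤ (1 + δ) * d}
      ≤ n * (4 * Real.exp (-(δ ^ 2 / 16 * d))) := by
  refine (measureReal_not_forall_le fun t => ?_).trans_eq (by rw [Fintype.card_fin])
  have hmeas : MeasurableSet {G : Matrix (Fin d) (Fin V) ℝ | ¬ ((1 - 2 * δ) * d
      ≤ colNorm G (tok t) ^ 2 ∧ colNorm G (tok t) ^ 2 ≤ (1 + δ) * d)} :=
    ((measurableSet_le measurable_const ((measurable_colNorm measurable_id _).pow_const 2)).inter
      (measurableSet_le ((measurable_colNorm measurable_id _).pow_const 2) measurable_const)).compl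
  have h := measureReal_not_colNorm_sq_le (a := d) one_pos hδ₀ hδ₂ (tok t)
  simp only [NNReal.coe_one, mul_one] at h
  rwa [← hG.law_embedding.map_eq, map_measureReal_apply_of_aemeasurable
    hG.law_embedding.aemeasurable hmeas] at h

end GaussianInit

end Random

/-! ### Stable ranks in the random network -/

section StableRank

variable {L d nHead dHead k n V : ℕ} {hd : d = nHead * dHead} {σ : ℝ → ℝ} {stσ pσ : ℝ}

variable (hd σ stσ pσ) in
/-- The stable rank bounds for the activations of a forward pass, with respect to the token
frequency `pMax tok` at the first layer and to the activation levels `stσ`, `pσ` further on. -/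
structure StableRankBounds (tok : Fin n → Fin V) (E : Matrix (Fin d) (Fin V) ℝ)
    (θ : Fin L → Layer d nHead dHead k n) : Prop where
  postAct : ∀ ℓ, stableRank (B hd σ θ (embed tok E) ℓ) ≤ stσ
  embed : stableRank (embed tok E) ≤ 1.01 / pMax tok
  rms_zero : stableRank (rmsNorm (MSITransformer.embed tok E)) ≤ 1.03 / pMax tok
  mlp_zero : ∀ ℓ : Fin L, ℓ.castSucc = 0 →
    stableRank (Amlp hd σ θ (MSITransformer.embed tok E) ℓ) ≤ 6.03 / pMax tok
  rms : ∀ m ≠ 0, stableRank (rmsNorm (hidden hd σ θ (MSITransformer.embed tok E) m))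
    ≤ 1.11 * (stσ / pσ) * (m + 1 : ℝ) ^ 2
  mlp : ∀ ℓ : Fin L, ℓ.castSucc ≠ 0 → stableRank (Amlp hd σ θ (MSITransformer.embed tok E) ℓ)
    ≤ 2.22 * (stσ / pσ) * (ℓ + 1 : ℝ) ^ 2

lemma ConcentratedForward.stableRankBounds {tok : Fin n → Fin V} {E : Matrix (Fin d) (Fin V) ℝ}
    {θ : Fin L → Layer d nHead dHead k n}
    (h : ConcentratedForward hd σ stσ pσ θ (MSITransformer.embed tok E)) (hd₀ : 0 < d)
    (hk₀ : 0 < k) (hn₀ : 0 < n) (hp : 0 < pσ) : StableRankBounds hd σ stσ pσ tok E θ where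
  postAct ℓ := ((h.layer ℓ).spike fun t => (h.layer ℓ).colNorm_att_ne_zero (by norm_num)
    (h.colNorm_hidden_ne_zero hd₀ ℓ.castSucc t)).1
  embed := h.stableRank_embed_le hd₀ hn₀
  rms_zero := h.stableRank_rmsNorm_embed_le hd₀ hn₀
  mlp_zero _ := h.stableRank_rmsNorm_att_embed_le hd₀ hk₀ hn₀
  rms _ := h.stableRank_rmsNorm_hidden_le hd₀ hk₀ hn₀ hp
  mlp _ := h.stableRank_rmsNorm_att_le hd₀ hk₀ hn₀ hp

variable {Ω : Type*} [MeasurableSpace Ω] {μ : Measure Ω} [IsProbabilityMeasure μ]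
  {E : Ω → Matrix (Fin d) (Fin V) ℝ} {θ : Fin L → Ω → Layer d nHead dHead k n}

lemma GaussianInit.measureReal_not_concentratedForward_le (hG : GaussianInit μ E θ)
    {Psucc : ℕ → ℕ → ℕ → ℝ} (hspike : MeanSpike σ stσ pσ Psucc) (hd₁ : 1 ≤ d) (hk₁ : 1 ≤ k)
    (hn₁ : 1 ≤ n) (tok : Fin n → Fin V) :
    μ.real {ω | ¬ ConcentratedForward hd σ stσ pσ (θ · ω) (embed tok (E ω))}
      ≤ 25 * (L + 1) * (n * Real.exp (-(d / 4000000))) + L * (n * Real.exp (-(k / 4000000)))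
        + L * (1 - Psucc d k n) := by
  have hinput := hG.measureReal_not_colNorm_embed_sq_le (δ := 1 / 500) (by norm_num) (by norm_num)
    tok
  have hlayer := measureReal_not_forall_le fun ℓ => hG.measureReal_not_concentrated_le (hd := hd)
    hspike (δ := 1 / 500) (by norm_num) (by norm_num) hd₁ hk₁ hn₁ tok ℓ
  have hexp : ∀ x : ℝ, -((1 / 500) ^ 2 / 16 * x) = -(x / 4000000) := fun x => by ring
  simp only [hexp, Fintype.card_fin] at hinput hlayer
  have hunion := measureReal_not_and_le hinput hlayer
  have : 0 ≤ n * Real.exp (-(d / 4000000 : ℝ)) := by positivity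
  refine ((measureReal_mono ?_).trans hunion).trans (by linarith)
  exact fun ω hω hgood => hω
    ⟨fun t => ⟨by linarith [(hgood.1 t).1], by linarith [(hgood.1 t).2]⟩, hgood.2⟩

lemma GaussianInit.le_measureReal_stableRankBounds (hG : GaussianInit μ E θ)
    {Psucc : ℕ → ℕ → ℕ → ℝ} (hspike : MeanSpike σ stσ pσ Psucc) (hp : 0 < pσ) (hd₁ : 1 ≤ d)
    (hk₁ : 1 ≤ k) (hn₁ : 1 ≤ n) (tok : Fin n → Fin V) :
    1 - 25 * (L + 1) * (n * Real.exp (-(d / 4000000))) - L * (n * Real.exp (-(k / 4000000)))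
        - L * (1 - Psucc d k n)
      ≤ μ.real {ω | StableRankBounds hd σ stσ pσ tok (E ω) (θ · ω)} := by
  have hbad := hG.measureReal_not_concentratedForward_le (hd := hd) hspike hd₁ hk₁ hn₁ tok
  have hsum := measureReal_union_le (μ := μ)
    {ω | ConcentratedForward hd σ stσ pσ (θ · ω) (embed tok (E ω))}
    {ω | ¬ ConcentratedForward hd σ stσ pσ (θ · ω) (embed tok (E ω))}
  rw [← Set.ofPred_or] at hsum
  simp only [em, Set.ofPred_true, probReal_univ] at hsum
  have hmono : μ.real {ω | ConcentratedForward hd σ stσ pσ (θ · ω) (embed tok (E ω))}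
      ≤ μ.real {ω | StableRankBounds hd σ stσ pσ tok (E ω) (θ · ω)} :=
    measureReal_mono fun ω hω => hω.stableRankBounds hd₁ hk₁ hn₁ hp
  linarith

end StableRank

lemma natCast_mul_exp_neg_two_mul_le {L n : ℕ} {x c : ℝ} (hc : 0 < c) (hL : 1 ≤ L) (hn : 1 ≤ n)
    (hx : 0 ≤ x) (h : 1 / c * (L : ℝ) ^ 2 * Real.log (n * L) ≤ x) :
    n * Real.exp (-(2 * c * x)) ≤ Real.exp (-(c * (x / (L : ℝ) ^ 2))) := by
  have hL₁ : (1 : ℝ) ≤ L := by exact_mod_cast hL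
  have hn₀ : (0 : ℝ) < n := by exact_mod_cast hn
  have hlog : Real.log n ≤ c * (x / (L : ℝ) ^ 2) := by
    calc Real.log n ≤ Real.log (n * L) :=
          Real.log_le_log hn₀ (le_mul_of_one_le_right hn₀.le hL₁)
      _ = c * ((1 / c * (L : ℝ) ^ 2 * Real.log (n * L)) / (L : ℝ) ^ 2) := by field_simp
      _ ≤ c * (x / (L : ℝ) ^ 2) := by gcongr
  have hdiv : c * (x / (L : ℝ) ^ 2) ≤ c * x := by
    gcongr
    exact div_le_self hx (one_le_pow₀ hL₁)
  calc n * Real.exp (-(2 * c * x)) = Real.exp (Real.log n - 2 * c * x) := by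
        rw [Real.exp_sub, Real.exp_log hn₀, Real.exp_neg, div_eq_mul_inv]
    _ ≤ Real.exp (-(c * (x / (L : ℝ) ^ 2))) := Real.exp_le_exp.mpr (by linarith)

section StableRank

variable {L d nHead dHead k n V : ℕ} {hd : d = nHead * dHead} {σ : ℝ → ℝ} {stσ pσ : ℝ}
  {Ω : Type*} [MeasurableSpace Ω] {μ : Measure Ω} [IsProbabilityMeasure μ]
  {E : Ω → Matrix (Fin d) (Fin V) ℝ} {θ : Fin L → Ω → Layer d nHead dHead k n}

lemma GaussianInit.le_measureReal_stableRankBounds_of_log_le (hG : GaussianInit μ E θ)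
    {Psucc : ℕ → ℕ → ℕ → ℝ} (hspike : MeanSpike σ stσ pσ Psucc) (hp : 0 < pσ) (hL : 1 ≤ L)
    (hd₁ : 1 ≤ d) (hk₁ : 1 ≤ k) (hn₁ : 1 ≤ n) (tok : Fin n → Fin V)
    (hd_log : 8000000 * (L : ℝ) ^ 2 * Real.log (n * L) ≤ d)
    (hk_log : 8000000 * (L : ℝ) ^ 2 * Real.log (n * L) ≤ k) :
    1 - 50 * L * Real.exp (-(1 / 8000000 * (d / (L : ℝ) ^ 2)))
        - L * Real.exp (-(1 / 8000000 * (k / (L : ℝ) ^ 2))) - L * (1 - Psucc d k n)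
      ≤ μ.real {ω | StableRankBounds hd σ stσ pσ tok (E ω) (θ · ω)} := by
  have habsorb {x : ℝ} (hx : 0 ≤ x) (hlog : 8000000 * (L : ℝ) ^ 2 * Real.log (n * L) ≤ x) :
      n * Real.exp (-(x / 4000000)) ≤ Real.exp (-(1 / 8000000 * (x / (L : ℝ) ^ 2))) := by
    convert natCast_mul_exp_neg_two_mul_le (c := 1 / 8000000) (by norm_num) hL hn₁ hx
      (by rwa [one_div_one_div]) using 4
    ring
  have hL₁ : (1 : ℝ) ≤ L := by exact_mod_cast hL
  have hfactor : (25 * (L + 1) : ℝ) ≤ 50 * L := by linarith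
  refine le_trans ?_ (hG.le_measureReal_stableRankBounds hspike hp hd₁ hk₁ hn₁ tok)
  gcongr
  · exact habsorb d.cast_nonneg hd_log
  · exact habsorb k.cast_nonneg hk_log

end StableRank

lemma mul_add_one_sq_le {s q a b c x : ℝ} (hs : 0 ≤ s) (hq : 0 ≤ q) (ha : 0 ≤ a) (hc : 0 ≤ c)
    (hcb : 2 * c ≤ b) (hx : 1 ≤ x) :
    c * q * (x + 1) ^ 2 ≤ a * s * (1 + x) + b * q * (x * (x + 1)) := by
  have hsquare : (x + 1) ^ 2 ≤ 2 * (x * (x + 1)) := by nlinarith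
  calc c * q * (x + 1) ^ 2 ≤ c * q * (2 * (x * (x + 1))) := by gcongr
    _ = 2 * c * (q * (x * (x + 1))) := by ring
    _ ≤ b * (q * (x * (x + 1))) := by gcongr
    _ ≤ a * s * (1 + x) + b * q * (x * (x + 1)) := by
        have : 0 ≤ a * s * (1 + x) := by positivity
        linarith

end

end MSITransformer

open MSITransformer in
theorem mainTheorem3 :
    ∃ c C : ℝ, 0 < c ∧ 0 < C ∧
      ∀ (L nHead dHead d k n V : ℕ), 1 ≤ nHead → 1 ≤ d → 1 ≤ k → 1 ≤ n →
      ∀ (hL : 1 ≤ L) (hd : d = nHead * dHead) (tok : Fin n → Fin V)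
        (σ : ℝ → ℝ) (stσ pσ : ℝ) (Psucc : ℕ → ℕ → ℕ → ℝ),
        0 < pσ → MeanSpike σ stσ pσ Psucc →
      ∀ (Ω : Type*) [MeasurableSpace Ω] (μ : Measure Ω) [IsProbabilityMeasure μ]
        (E : Ω → Matrix (Fin d) (Fin V) ℝ) (θ : Fin L → Ω → Layer d nHead dHead k n),
        GaussianInit μ E θ →
        C * (L : ℝ) ^ 2 * Real.log ((n : ℝ) * L) ≤ d →
        C * (L : ℝ) ^ 2 * Real.log ((n : ℝ) * L) ≤ k →
        1 - C * L * Real.exp (-(c * (d / (L : ℝ) ^ 2)))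
            - C * L * Real.exp (-(c * (k / (L : ℝ) ^ 2)))
            - L * (1 - Psucc d k n)
          ≤ μ.real {ω |
            -- MLP post-activations
            (∀ ℓ : Fin L, stableRank (B hd σ (θ · ω) (embed tok (E ω)) ℓ) ≤ stσ) ∧
            -- embedding layer
            (stableRank (embed tok (E ω)) ≤ 1.01 / pMax tok ∧
              stableRank (Arms hd σ (θ · ω) (embed tok (E ω)) ⟨0, hL⟩) ≤ 1.03 / pMax tok ∧
              stableRank (Amlp hd σ (θ · ω) (embed tok (E ω)) ⟨0, hL⟩) ≤ 6.03 / pMax tok) ∧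
            -- RMS activations at depth at least one
            (∀ ℓ : Fin L, 1 ≤ (ℓ : ℕ) →
              stableRank (Arms hd σ (θ · ω) (embed tok (E ω)) ℓ)
                ≤ 2.1 * stσ * (1 + (ℓ : ℝ)) + 4.3 * (stσ / pσ) * ((ℓ : ℝ) * ((ℓ : ℝ) + 1)) ∧
              stableRank (Amlp hd σ (θ · ω) (embed tok (E ω)) ℓ)
                ≤ 6.4 * stσ * (1 + (ℓ : ℝ)) + 13 * (stσ / pσ) * ((ℓ : ℝ) * ((ℓ : ℝ) + 1))) ∧
            -- final RMS activations
            stableRank (Afinal hd σ (θ · ω) (embed tok (E ω)))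
              ≤ 2.1 * stσ * (1 + (L : ℝ)) + 4.3 * (stσ / pσ) * ((L : ℝ) * ((L : ℝ) + 1))} := by
  refine ⟨1 / 8000000, 8000000, by norm_num, by norm_num, ?_⟩
  intro L nHead dHead d k n V _ hd₁ hk₁ hn₁ hL hd tok σ stσ pσ Psucc hp hspike Ω _ μ _ E θ hG
    hd_log hk_log
  have hprob := hG.le_measureReal_stableRankBounds_of_log_le (hd := hd) hspike hp hL hd₁ hk₁ hn₁
    tok hd_log hk_log
  refine le_trans ?_ (hprob.trans (measureReal_mono fun ω h => ?_))
  · gcongr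
    · norm_num
    · exact le_mul_of_one_le_left L.cast_nonneg (by norm_num)
  · have hst : 0 ≤ stσ := (stableRank_nonneg _).trans (h.postAct ⟨0, hL⟩)
    have hquot : 0 ≤ stσ / pσ := div_nonneg hst hp.le
    have hL₁ : (1 : ℝ) ≤ L := by exact_mod_cast hL
    refine ⟨h.postAct, ⟨h.embed, h.rms_zero, h.mlp_zero _ rfl⟩, fun ℓ hℓ => ?_, ?_⟩
    · have hℓ₁ : (1 : ℝ) ≤ ℓ := by exact_mod_cast hℓ
      have hℓ₀ : ℓ.castSucc ≠ 0 := Fin.ne_of_val_ne (Nat.one_le_iff_ne_zero.mp hℓ)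
      exact ⟨(h.rms _ hℓ₀).trans (mul_add_one_sq_le hst hquot (by norm_num) (by norm_num)
          (by norm_num) hℓ₁),
        (h.mlp ℓ hℓ₀).trans (mul_add_one_sq_le hst hquot (by norm_num) (by norm_num)
          (by norm_num) hℓ₁)⟩
    · exact (h.rms (Fin.last L) (Fin.ne_of_val_ne (Nat.one_le_iff_ne_zero.mp hL))).trans
        (mul_add_one_sq_le hst hquot (by norm_num) (by norm_num) (by norm_num) hL₁)
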